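/- Let $W$ be an $8$-dimensional real vector space and let $\Phi\in\Lambda^4W^*$ be a $4$-form, i.e. an alternating multilinear map $\Phi:W^4\to\mathbb{R}$. An inner product $\langle\cdot,\cdot\rangle$ on $W$ is called *compatible* with $\Phi$ if the alternating trilinear map $W^3\to W$, $(u,v,w)\mapsto u\times v\times w$, determined by $$\langle x,u\times v\times w\rangle=\Phi(x,u,v,w)\qquad\text{for all }x,u,v,w\in W$$ is a triple cross product, that is, for all $u,v,w\in W$ the vector $u\times v\times w$ is orthogonal to $u$, $v$ and $w$, and $|u\times v\times w|=|u\wedge v\wedge w|$, where $|u\wedge v\wedge w|^2$ denotes the Gram determinant of $u,v,w$. The $4$-form $\Phi$ is called *nondegenerate* if for every linearly independent triple $u,v,w\in W$ there is an $x\in W$ with $\Phi(u,v,w,x)\neq0$. Write $\iota(v)\iota(u)\Phi$ for the $2$-form $\Phi(u,v,\cdot,\cdot)$. Then $\Phi$ admits a compatible inner product if and only if it satisfies the following condition. **(C)** $\Phi$ is nondegenerate and, whenever $u,v,w\in W$ are linearly independent and $$\iota(v)\iota(u)\Phi\wedge\iota(w)\iota(u)\Phi\wedge\Phi=\iota(u)\iota(v)\Phi\wedge\iota(w)\iota(v)\Phi\wedge\Phi=0,$$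 then for all $x\in W$ $$\iota(w)\iota(u)\Phi\wedge\iota(x)\iota(u)\Phi\wedge\Phi=0\iff\iota(w)\iota(v)\Phi\wedge\iota(x)\iota(v)\Phi\wedge\Phi=0.$$ If this holds, then the compatible inner product is uniquely determined by $\Phi$. -/

import Mathlib

namespace CayleyForm

variable {W : Type*} [AddCommGroup W] [Module ℝ W]

/-- An inner product on a real vector space: a symmetric, positive definite bilinear form. -/
structure IsInnerProduct (B : LinearMap.BilinForm ℝ W) : Prop where
  symm : ∀ u v : W, B u v = B v u
  pos : ∀ u : W, u ≠ 0 → 0 < B u u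

/-- `|u ∧ v ∧ w|²`, the squared volume of the parallelepiped spanned by `u, v, w`:
the Gram determinant of `u, v, w`. -/
noncomputable def wedgeNormSq (B : LinearMap.BilinForm ℝ W) (u v w : W) : ℝ :=
  Matrix.det !![B u u, B u v, B u w;
                B v u, B v v, B v w;
                B w u, B w v, B w w]

/-- An alternating trilinear map `T(u, v, w) = u × v × w` is a triple cross product for the inner
product `B` if `u × v × w` is orthogonal to `u, v, w` and `|u × v × w| = |u ∧ v ∧ w|`
(an equality of nonnegative reals, written for the squares). -/
structure IsTripleCrossProduct (B : LinearMap.BilinForm ℝ W) (T : W [⋀^Fin 3]→ₗ[ℝ] W) : Prop where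
  orth_fst : ∀ u v w : W, B (T ![u, v, w]) u = 0
  orth_snd : ∀ u v w : W, B (T ![u, v, w]) v = 0
  orth_trd : ∀ u v w : W, B (T ![u, v, w]) w = 0
  norm_sq : ∀ u v w : W, B (T ![u, v, w]) (T ![u, v, w]) = wedgeNormSq B u v w

/-- `B` is an inner product compatible with the 4-form `Φ`: the map `(u, v, w) ↦ u × v × w`
determined by `⟨x, u × v × w⟩ = Φ(x, u, v, w)` is a triple cross product. -/
def IsCompatible (B : LinearMap.BilinForm ℝ W) (Φ : W [⋀^Fin 4]→ₗ[ℝ] ℝ) : Prop :=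
  IsInnerProduct B ∧
    ∃ T : W [⋀^Fin 3]→ₗ[ℝ] W,
      (∀ x u v w : W, B x (T ![u, v, w]) = Φ ![x, u, v, w]) ∧ IsTripleCrossProduct B T

/-- A 4-form `Φ` is nondegenerate if for all linearly independent `u, v, w` there is an `x` with
`Φ(u, v, w, x) ≠ 0`. -/
def Nondegenerate (Φ : W [⋀^Fin 4]→ₗ[ℝ] ℝ) : Prop :=
  ∀ u v w : W, LinearIndependent ℝ ![u, v, w] → ∃ x : W, Φ ![u, v, w, x] ≠ 0

/-- The wedge product of alternating forms, normalized as a sum over shuffles. -/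
noncomputable def wedge {m n : ℕ} (a : W [⋀^Fin m]→ₗ[ℝ] ℝ) (b : W [⋀^Fin n]→ₗ[ℝ] ℝ) :
    W [⋀^Fin (m + n)]→ₗ[ℝ] ℝ :=
  ((LinearMap.mul' ℝ ℝ).compAlternatingMap (a.domCoprod b)).domDomCongr finSumFinEquiv

/-- The 2-form `ι(v)ι(u)Φ = Φ(u, v, ·, ·)`. -/
def contract₂ (Φ : W [⋀^Fin 4]→ₗ[ℝ] ℝ) (u v : W) : W [⋀^Fin 2]→ₗ[ℝ] ℝ :=
  (Φ.curryLeft u).curryLeft v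

/-- The 8-form `ι(v)ι(u)Φ ∧ ι(x)ι(w)Φ ∧ Φ`. -/
noncomputable def eightForm (Φ : W [⋀^Fin 4]→ₗ[ℝ] ℝ) (u v w x : W) : W [⋀^Fin 8]→ₗ[ℝ] ℝ :=
  wedge (wedge (contract₂ Φ u v) (contract₂ Φ w x)) Φ

/-- Condition (C) for a 4-form. -/
def ConditionC (Φ : W [⋀^Fin 4]→ₗ[ℝ] ℝ) : Prop :=
  Nondegenerate Φ ∧
    ∀ u v w : W, LinearIndependent ℝ ![u, v, w] →
      eightForm Φ u v u w = 0 → eightForm Φ v u v w = 0 →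
        ∀ x : W, eightForm Φ u w u x = 0 ↔ eightForm Φ v w v x = 0

end CayleyForm

/-! Let R(u,v,w,x) be the coefficient, in a fixed basis, of the 8-form ι(v)ι(u)Φ ∧ ι(x)ι(w)Φ ∧ Φ; it
is a symmetric bilinear form on bivectors. Given a compatible inner product, Φ(u,v,·,·) is, for
orthonormal u, v, the 2-form of an orthogonal complex structure on the complement of u, v. It
therefore has Pfaffian ±1, and for a suitable orientation R(u,v,u,w) is a positive multiple of
|u|²⟨v,w⟩ − ⟨u,v⟩⟨u,w⟩ (`IsCompatible.exists_eightFormAt_eq`). The hypotheses in (C) then say that w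
is orthogonal to u and v, and both sides of its equivalence say that w is orthogonal to x. For
uniqueness, the formula makes two compatible inner products share their orthogonality relation, so
they are proportional, and the norm identity fixes the factor.

Conversely, the metric is rebuilt from R. Nondegeneracy makes Φ(u,v,·,·) symplectic modulo u, v, so
R(u,v,u,v) ≠ 0 for independent u, v; its sign is constant, and positive after a choice of
orientation. Condition (C) says that for w "normal" to a and b the functionals R(a,w,a,·) and
R(b,w,b,·) have the same kernel. Their ratio turns out not to depend on w, and it is the candidate
for |b|²/|a|². In dimension 8 some nonzero vector is normal to several pairs at once; this makes the
ratios multiplicative (`exists_isConformalFactor`) and the squared length quadratic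
(`exists_companion`). A rescaling of the resulting metric satisfies R(u,v,u,v) = |u∧v|²
(`exists_innerProduct`).

It remains to pass from "Φ(u,v,·,·) has Pfaffian |u∧v|² vol" (`HasPfaffian`) to |Φ(u,v,w,·)| = 1 for
orthonormal u, v, w. With the volume normalised, let c be the maximum of Φ on quadruples of unit
vectors. In a frame adapted to a maximum, the Pfaffian identities become relations among three skew
4×4 matrices that force c = 1 (`pfaffian_pow_six_eq_one`, `IsCriticalFrame.value_eq_one`). For any
orthonormal u, v, w the Pfaffian in an adapted frame is a product of three values of Φ, each at most
1 in absolute value, and it equals ±1; so each factor is ±1. -/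

namespace CayleyForm

/-! ### Alternating sums and the wedge product -/

section

open Equiv
variable {W : Type*} [AddCommGroup W] [Module ℝ W]

/-- The alternating sum of a function of `n` vectors over all permutations of its arguments. -/
noncomputable def altSum {M : Type*} {n : ℕ} (F : (Fin n → M) → ℝ) (y : Fin n → M) : ℝ :=
  ∑ σ : Perm (Fin n), ((Perm.sign σ : ℤ) : ℝ) * F (y ∘ σ)

/-- Since `k.cycleRange` carries k to 0, k is recovered as the preimage of 0, and the other factor
fixes 0. -/
theorem bijective_decomposeFin_mul_cycleRange (n : ℕ) :
    Function.Bijective (fun p : Fin (n + 1) × Perm (Fin n) =>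
      Perm.decomposeFin.symm (0, p.2) * p.1.cycleRange) := by
  rw [Fintype.bijective_iff_injective_and_card]
  constructor
  · rintro ⟨k, τ⟩ ⟨k', τ'⟩ h
    simp only at h
    have hk : k = k' := by
      have h1 := congrArg (fun σ : Perm (Fin (n + 1)) => σ k) h
      simp only [Perm.coe_mul, Function.comp_apply, Fin.cycleRange_self,
        Perm.decomposeFin_symm_apply_zero] at h1
      have h2 : Perm.decomposeFin.symm (0, τ') 0 = (0 : Fin (n + 1)) := by simp
      have h3 := (Perm.decomposeFin.symm (0, τ')).injective (h2.trans h1)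
      exact k'.cycleRange.injective ((Fin.cycleRange_self k').trans h3).symm
    subst hk
    have h1 := Perm.decomposeFin.symm.injective (mul_right_cancel h)
    simpa using h1
  · simp [Fintype.card_perm, Nat.factorial_succ]

/-- The permutations are sorted by the slot k in which x lands; the cycle bringing it there has sign
(-1)^k. -/
theorem altSum_cons {M : Type*} {n : ℕ} (F : (Fin (n + 1) → M) → ℝ) (x : M) (y : Fin n → M) :
    altSum F (Fin.cons x y) =
      ∑ k : Fin (n + 1), (-1 : ℝ) ^ (k : ℕ) * altSum (fun z => F (k.insertNth x z)) y := by
  unfold altSum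
  rw [← (Equiv.ofBijective _ (bijective_decomposeFin_mul_cycleRange n)).sum_comp,
    Fintype.sum_prod_type]
  refine Finset.sum_congr rfl fun k _ => ?_
  rw [Finset.mul_sum]
  refine Finset.sum_congr rfl fun τ _ => ?_
  have h1 : (Fin.cons x y : Fin (n + 1) → M) ∘
      (Perm.decomposeFin.symm (0, τ) * k.cycleRange : Perm (Fin (n + 1))) =
      k.insertNth x (y ∘ τ) := by
    rw [Perm.coe_mul, ← Function.comp_assoc]
    have : (Fin.cons x y : Fin (n + 1) → M) ∘ (Perm.decomposeFin.symm (0, τ) : Perm (Fin (n + 1))) =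
        Fin.cons x (y ∘ τ) := by
      funext i
      refine Fin.cases ?_ (fun j => ?_) i <;> simp
    rw [this, Fin.cons_comp_cycleRange]
  simp only [Equiv.ofBijective_apply]
  rw [h1, Perm.sign_mul, Perm.decomposeFin.symm_sign, Fin.sign_cycleRange]
  push_cast
  simp
  ring

/-- Here the sorting is by the vector that occupies the first slot, which amounts to decomposing the
inverse permutation. -/
theorem altSum_slot {M : Type*} {n : ℕ} (F : (Fin (n + 1) → M) → ℝ) (y : Fin (n + 1) → M) :
    altSum F y =
      ∑ p : Fin (n + 1), (-1 : ℝ) ^ (p : ℕ) *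
        altSum (fun z => F (Fin.cons (y p) z)) (y ∘ p.succAbove) := by
  unfold altSum
  rw [← Equiv.sum_comp (Equiv.inv (Perm (Fin (n + 1)))),
    ← (Equiv.ofBijective _ (bijective_decomposeFin_mul_cycleRange n)).sum_comp,
    Fintype.sum_prod_type]
  refine Finset.sum_congr rfl fun k _ => ?_
  rw [Finset.mul_sum, ← Equiv.sum_comp (Equiv.inv (Perm (Fin n)))]
  refine Finset.sum_congr rfl fun τ _ => ?_
  have h1 : y ∘ ((Perm.decomposeFin.symm (0, τ⁻¹) * k.cycleRange)⁻¹ : Perm (Fin (n + 1))) =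
      Fin.cons (y k) ((y ∘ k.succAbove) ∘ τ) := by
    have h2 : (Perm.decomposeFin.symm (0, τ⁻¹))⁻¹ = Perm.decomposeFin.symm ((0 : Fin (n + 1)), τ) := by
      rw [inv_eq_iff_mul_eq_one]
      ext i
      refine Fin.cases ?_ (fun j => ?_) i <;> simp
    rw [mul_inv_rev, h2]
    funext i
    refine Fin.cases ?_ (fun j => ?_) i
    · simp [Perm.inv_def]
    · simp [Perm.inv_def]
  simp only [Equiv.ofBijective_apply, Equiv.inv_apply]
  rw [h1, Perm.sign_inv, Perm.sign_mul, Perm.decomposeFin.symm_sign, Fin.sign_cycleRange]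
  push_cast
  simp
  ring

theorem altSum_zero_args {M : Type*} (F : (Fin 0 → M) → ℝ) (y : Fin 0 → M) :
    altSum F y = F y := by
  unfold altSum
  simp [Subsingleton.elim _ y]

theorem altSum_alternatingMap {n : ℕ} (a : W [⋀^Fin n]→ₗ[ℝ] ℝ) (y : Fin n → W) :
    altSum (fun z => a z) y = n.factorial * a y := by
  unfold altSum
  have : ∀ σ : Perm (Fin n), ((Perm.sign σ : ℤ) : ℝ) * a (y ∘ σ) = a y := by
    intro σ
    rw [AlternatingMap.map_perm]
    rcases Int.units_eq_one_or (Perm.sign σ) with h | h <;> simp [h]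
  simp [this, Fintype.card_perm]

/-- Each shuffle represents a coset of m! n! permutations, all contributing the same term. -/
theorem wedge_eq_altSum {m n : ℕ} (a : W [⋀^Fin m]→ₗ[ℝ] ℝ) (b : W [⋀^Fin n]→ₗ[ℝ] ℝ)
    (y : Fin (m + n) → W) :
    (m.factorial * n.factorial : ℝ) * wedge a b y =
      altSum (fun z => a (fun i => z (Fin.castAdd n i)) * b (fun i => z (Fin.natAdd m i))) y := by
  have h := congrArg (fun f => LinearMap.mul' ℝ ℝ (f (y ∘ finSumFinEquiv)))
    (MultilinearMap.domCoprod_alternization_eq a b)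
  simp only [AlternatingMap.smul_apply, Fintype.card_fin, map_nsmul] at h
  have h2 : wedge a b y = LinearMap.mul' ℝ ℝ ((a.domCoprod b) (y ∘ finSumFinEquiv)) := rfl
  rw [h2, ← Nat.cast_mul, ← nsmul_eq_mul, ← h, MultilinearMap.alternatization_apply, map_sum]
  unfold altSum
  rw [← (Equiv.permCongr (finSumFinEquiv (m := m) (n := n))).sum_comp]
  refine Finset.sum_congr rfl fun σ _ => ?_
  rw [Perm.sign_permCongr]
  rcases Int.units_eq_one_or (Perm.sign σ) with h | h <;>
    simp [h, MultilinearMap.domCoprod_apply, Function.comp_def, Equiv.permCongr_apply]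

end

/-! ### Explicit expansions in low degree -/

section

open Equiv
variable {W : Type*} [AddCommGroup W] [Module ℝ W]

theorem altSum_zero {M : Type*} (F : (Fin 0 → M) → ℝ) (y : Fin 0 → M) :
    altSum F y = F ![] := by
  rw [altSum_zero_args, Subsingleton.elim y]

theorem altSum_one {M : Type*} (F : (Fin 1 → M) → ℝ) (x : M) :
    altSum F ![x] = F ![x] := by
  rw [altSum_slot]
  simp [altSum_zero]

theorem altSum_two {M : Type*} (F : (Fin 2 → M) → ℝ) (x y : M) :
    altSum F ![x, y] = F ![x, y] - F ![y, x] := by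
  rw [altSum_slot]
  have h0 : (![x, y] ∘ (0 : Fin 2).succAbove) = ![y] := by funext i; fin_cases i; rfl
  have h1 : (![x, y] ∘ (1 : Fin 2).succAbove) = ![x] := by funext i; fin_cases i; rfl
  rw [Fin.sum_univ_two, h0, h1, altSum_one, altSum_one]
  simp
  rfl

theorem altSum_three {M : Type*} (F : (Fin 3 → M) → ℝ) (x y z : M) :
    altSum F ![x, y, z] = altSum (fun t => F (Fin.cons x t)) ![y, z] -
      altSum (fun t => F (Fin.cons y t)) ![x, z] + altSum (fun t => F (Fin.cons z t)) ![x, y] := by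
  rw [altSum_slot]
  have h0 : (![x, y, z] ∘ (0 : Fin 3).succAbove) = ![y, z] := by funext i; fin_cases i <;> rfl
  have h1 : (![x, y, z] ∘ (1 : Fin 3).succAbove) = ![x, z] := by funext i; fin_cases i <;> rfl
  have h2 : (![x, y, z] ∘ (2 : Fin 3).succAbove) = ![x, y] := by funext i; fin_cases i <;> rfl
  rw [Fin.sum_univ_three, h0, h1, h2]
  simp
  ring

theorem altSum_four {M : Type*} (F : (Fin 4 → M) → ℝ) (x y z w : M) :
    altSum F ![x, y, z, w] = altSum (fun t => F (Fin.cons x t)) ![y, z, w] -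
      altSum (fun t => F (Fin.cons y t)) ![x, z, w] + altSum (fun t => F (Fin.cons z t)) ![x, y, w]
      - altSum (fun t => F (Fin.cons w t)) ![x, y, z] := by
  rw [altSum_slot]
  have h0 : (![x, y, z, w] ∘ (0 : Fin 4).succAbove) = ![y, z, w] := by
    funext i; fin_cases i <;> rfl
  have h1 : (![x, y, z, w] ∘ (1 : Fin 4).succAbove) = ![x, z, w] := by
    funext i; fin_cases i <;> rfl
  have h2 : (![x, y, z, w] ∘ (2 : Fin 4).succAbove) = ![x, y, w] := by
    funext i; fin_cases i <;> rfl
  have h3 : (![x, y, z, w] ∘ (3 : Fin 4).succAbove) = ![x, y, z] := by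
    funext i; fin_cases i <;> rfl
  rw [Fin.sum_univ_four, h0, h1, h2, h3]
  simp
  norm_num
  ring

theorem twoForm_swap (c : W [⋀^Fin 2]→ₗ[ℝ] ℝ) (u v : W) : c ![v, u] = - c ![u, v] := by
  have := c.map_swap ![u, v] (show (0 : Fin 2) ≠ 1 by decide)
  rw [← this]
  congr 1
  funext i; fin_cases i <;> rfl

theorem twoForm_eta (c : W [⋀^Fin 2]→ₗ[ℝ] ℝ) (f : Fin 2 → W) : c f = c ![f 0, f 1] := by
  congr 1
  funext i; fin_cases i <;> rfl

theorem wedge_two_two (a b : W [⋀^Fin 2]→ₗ[ℝ] ℝ) (x y z w : W) :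
    wedge a b ![x, y, z, w] = a ![x, y] * b ![z, w] - a ![x, z] * b ![y, w]
      + a ![x, w] * b ![y, z] + a ![y, z] * b ![x, w] - a ![y, w] * b ![x, z]
      + a ![z, w] * b ![x, y] := by
  have hs := twoForm_swap (W := W)
  have h := wedge_eq_altSum a b ![x, y, z, w]
  have e : (fun z : Fin (2 + 2) → W => a (fun i => z (Fin.castAdd 2 i)) *
      b (fun i => z (Fin.natAdd 2 i))) = fun t => a ![t 0, t 1] * b ![t 2, t 3] := by
    funext t
    rw [twoForm_eta a, twoForm_eta b]
    rfl
  rw [e] at h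
  simp only [altSum_four, altSum_three, altSum_two] at h
  change _ = a ![x, y] * b ![z, w] - a ![x, y] * b ![w, z]
    - (a ![x, z] * b ![y, w] - a ![x, z] * b ![w, y])
    + (a ![x, w] * b ![y, z] - a ![x, w] * b ![z, y])
    - (a ![y, x] * b ![z, w] - a ![y, x] * b ![w, z]
    - (a ![y, z] * b ![x, w] - a ![y, z] * b ![w, x])
    + (a ![y, w] * b ![x, z] - a ![y, w] * b ![z, x]))
    + (a ![z, x] * b ![y, w] - a ![z, x] * b ![w, y]
    - (a ![z, y] * b ![x, w] - a ![z, y] * b ![w, x])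
    + (a ![z, w] * b ![x, y] - a ![z, w] * b ![y, x]))
    - (a ![w, x] * b ![y, z] - a ![w, x] * b ![z, y]
    - (a ![w, y] * b ![x, z] - a ![w, y] * b ![z, x])
    + (a ![w, z] * b ![x, y] - a ![w, z] * b ![y, x])) at h
  rw [hs a x y, hs a x z, hs a x w, hs a y z, hs a y w, hs a z w,
    hs b x y, hs b x z, hs b x w, hs b y z, hs b y w, hs b z w] at h
  norm_num [Nat.factorial] at h
  linarith
end

/-! ### Contraction of a wedge product -/

section

open Equiv
variable {W : Type*} [AddCommGroup W] [Module ℝ W]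

/-- The antiderivation rule when ι(u)a = 0: only terms with u in a slot of b survive, the n + 1 such
slots contribute equally, and moving u past the slots of a costs (-1)^m. -/
theorem wedge_cons_of_annihilates {m n : ℕ} (a : W [⋀^Fin m]→ₗ[ℝ] ℝ) (b : W [⋀^Fin (n + 1)]→ₗ[ℝ] ℝ)
    (u : W) (hu : ∀ (z : Fin m → W) (i : Fin m), z i = u → a z = 0) (y : Fin (m + n) → W) :
    wedge a b (Fin.cons u y : Fin (m + n + 1) → W) = (-1) ^ m * wedge a (b.curryLeft u) y := by
  have h1 := (wedge_eq_altSum a b (Fin.cons u y : Fin (m + n + 1) → W)).trans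
    (altSum_cons (n := m + n) _ u y)
  have h2 := wedge_eq_altSum a (b.curryLeft u) y
  have hz : ∀ (k : Fin (m + n + 1)) (z : Fin (m + n) → W) (i : Fin m),
      (k : ℕ) = i → (k.insertNth u z : Fin (m + n + 1) → W) (Fin.castAdd (n + 1) i) = u := by
    intro k z i h
    have : Fin.castAdd (n + 1) i = k := by ext; simp [h]
    rw [this]; simp
  have hs : ∑ k : Fin (m + (n + 1)), (-1 : ℝ) ^ (k : ℕ) * altSum (fun z : Fin (m + n) → W =>
      a (fun i => (k.insertNth u z : Fin (m + n + 1) → W) (Fin.castAdd (n + 1) i)) *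
      b (fun i => (k.insertNth u z : Fin (m + n + 1) → W) (Fin.natAdd m i))) y =
      (n + 1) * ((-1) ^ m * altSum (fun z => a (fun i => z (Fin.castAdd n i)) *
        (b.curryLeft u) (fun i => z (Fin.natAdd m i))) y) := by
    rw [Fin.sum_univ_add]
    have A : ∀ i : Fin m, altSum (fun z : Fin (m + n) → W =>
      a (fun j => ((Fin.castAdd (n + 1) i).insertNth u z : Fin (m + n + 1) → W)
        (Fin.castAdd (n + 1) j)) *
      b (fun j => ((Fin.castAdd (n + 1) i).insertNth u z : Fin (m + n + 1) → W)
        (Fin.natAdd m j))) y = 0 := by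
      intro i
      unfold altSum
      refine Finset.sum_eq_zero fun σ _ => ?_
      beta_reduce
      rw [hu (fun j => ((Fin.castAdd (n + 1) i).insertNth u (y ∘ σ) : Fin (m + n + 1) → W)
        (Fin.castAdd (n + 1) j)) i (hz _ _ _ rfl)]
      simp
    have B : ∀ j : Fin (n + 1), (fun z : Fin (m + n) → W =>
      a (fun i => ((Fin.natAdd m j).insertNth u z : Fin (m + n + 1) → W)
        (Fin.castAdd (n + 1) i)) *
      b (fun i => ((Fin.natAdd m j).insertNth u z : Fin (m + n + 1) → W)
        (Fin.natAdd m i))) = fun z => (-1) ^ (j : ℕ) * (a (fun i => z (Fin.castAdd n i)) *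
        (b.curryLeft u) (fun i => z (Fin.natAdd m i))) := by
      intro j
      funext z
      have e1 : (fun i => ((Fin.natAdd m j).insertNth u z : Fin (m + n + 1) → W)
        (Fin.castAdd (n + 1) i)) = fun i => z (Fin.castAdd n i) := by
        funext i
        have : Fin.castAdd (n + 1) i = (Fin.natAdd m j : Fin (m + n + 1)).succAbove
            (Fin.castAdd n i) := by
          rw [Fin.succAbove_of_castSucc_lt]
          · ext; simp
          · simp [Fin.lt_def]; omega
        rw [this, Fin.insertNth_apply_succAbove]
      have e2 : (fun i => ((Fin.natAdd m j).insertNth u z : Fin (m + n + 1) → W)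
        (Fin.natAdd m i)) = j.insertNth u (fun i => z (Fin.natAdd m i)) := by
        funext i
        refine Fin.succAboveCases j ?_ (fun i => ?_) i
        · have : (Fin.natAdd m j : Fin (m + n + 1)) = Fin.natAdd m j := rfl
          rw [Fin.insertNth_apply_same, Fin.insertNth_apply_same]
        · have : (Fin.natAdd m (j.succAbove i) : Fin (m + n + 1)) =
            (Fin.natAdd m j : Fin (m + n + 1)).succAbove (Fin.natAdd m i) := by
            ext
            simp only [Fin.succAbove, Fin.lt_def]
            by_cases h : (i : ℕ) < j <;> simp [h] <;> rfl
          rw [this, Fin.insertNth_apply_succAbove, Fin.insertNth_apply_succAbove]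
      rw [e1, e2, AlternatingMap.map_insertNth]
      simp [Matrix.vecCons]
      ring
    have C : ∀ (c : ℝ) (F : (Fin (m + n) → W) → ℝ), altSum (fun z => c * F z) y =
        c * altSum F y := by
      intro c F
      unfold altSum
      rw [Finset.mul_sum]
      exact Finset.sum_congr rfl fun _ _ => by ring
    simp only [A, B, C, mul_zero, Finset.sum_const_zero, zero_add]
    have D : ∀ (j : Fin (n + 1)) (s : ℝ), (-1 : ℝ) ^ ((Fin.natAdd m j : Fin (m + (n + 1))) : ℕ) *
        ((-1) ^ (j : ℕ) * s) = (-1) ^ m * s := by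
      intro j s
      have : (-1 : ℝ) ^ (j : ℕ) * (-1) ^ (j : ℕ) = 1 := by
        rw [← mul_pow]; simp
      rw [Fin.val_natAdd, pow_add]
      linear_combination (-1 : ℝ) ^ m * s * this
    simp only [D]
    simp
  have h3 : (m.factorial * (n + 1).factorial : ℝ) * wedge a b (Fin.cons u y : Fin (m + n + 1) → W)
      = (n + 1) * ((-1) ^ m * ((m.factorial * n.factorial : ℝ) * wedge a (b.curryLeft u) y)) := by
    rw [h2, ← hs]; exact h1
  have p1 : (m.factorial : ℝ) ≠ 0 := by positivity
  have p2 : (n.factorial : ℝ) ≠ 0 := by positivity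
  have p3 : (n + 1 : ℝ) ≠ 0 := by positivity
  rw [Nat.factorial_succ] at h3
  push_cast at h3
  have := mul_ne_zero (mul_ne_zero p1 p2) p3
  apply mul_left_cancel₀ this
  linear_combination h3

end

/-! ### Wedge of a 4-form with a 2-form, and the Pfaffian -/

section

open Equiv
variable {W : Type*} [AddCommGroup W] [Module ℝ W]

theorem altSum_comp_perm {M : Type*} {n : ℕ} (F : (Fin n → M) → ℝ) (ρ : Perm (Fin n))
    (y : Fin n → M) :
    altSum (fun z => F (z ∘ ρ)) y = ((Perm.sign ρ : ℤ) : ℝ) * altSum F y := by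
  unfold altSum
  rw [← Equiv.sum_comp (Equiv.mulRight ρ⁻¹), Finset.mul_sum]
  refine Finset.sum_congr rfl fun σ _ => ?_
  simp only [Equiv.coe_mulRight, Perm.sign_mul, Perm.sign_inv, Function.comp_assoc,
    ← Perm.coe_mul, inv_mul_cancel_right]
  push_cast
  ring

theorem altSum_const_mul {M : Type*} {n : ℕ} (F : (Fin n → M) → ℝ) (c : ℝ) (y : Fin n → M) :
    altSum (fun z => c * F z) y = c * altSum F y := by
  unfold altSum
  rw [Finset.mul_sum]
  exact Finset.sum_congr rfl fun _ _ => by ring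

theorem fourForm_eta (p : W [⋀^Fin 4]→ₗ[ℝ] ℝ) (f : Fin 4 → W) : p f = p ![f 0, f 1, f 2, f 3] := by
  congr 1
  funext i; fin_cases i <;> rfl

theorem altSum_five {M : Type*} (F : (Fin 5 → M) → ℝ) (x y z w v : M) :
    altSum F ![x, y, z, w, v] = altSum (fun t => F (Fin.cons x t)) ![y, z, w, v] -
      altSum (fun t => F (Fin.cons y t)) ![x, z, w, v]
      + altSum (fun t => F (Fin.cons z t)) ![x, y, w, v]
      - altSum (fun t => F (Fin.cons w t)) ![x, y, z, v]
      + altSum (fun t => F (Fin.cons v t)) ![x, y, z, w] := by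
  rw [altSum_slot]
  have h0 : (![x, y, z, w, v] ∘ (0 : Fin 5).succAbove) = ![y, z, w, v] := by
    funext i; fin_cases i <;> rfl
  have h1 : (![x, y, z, w, v] ∘ (1 : Fin 5).succAbove) = ![x, z, w, v] := by
    funext i; fin_cases i <;> rfl
  have h2 : (![x, y, z, w, v] ∘ (2 : Fin 5).succAbove) = ![x, y, w, v] := by
    funext i; fin_cases i <;> rfl
  have h3 : (![x, y, z, w, v] ∘ (3 : Fin 5).succAbove) = ![x, y, z, v] := by
    funext i; fin_cases i <;> rfl
  have h4 : (![x, y, z, w, v] ∘ (4 : Fin 5).succAbove) = ![x, y, z, w] := by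
    funext i; fin_cases i <;> rfl
  rw [Fin.sum_univ_five, h0, h1, h2, h3, h4]
  simp
  norm_num
  ring

theorem altSum_six {M : Type*} (F : (Fin 6 → M) → ℝ) (x y z w v u : M) :
    altSum F ![x, y, z, w, v, u] = altSum (fun t => F (Fin.cons x t)) ![y, z, w, v, u] -
      altSum (fun t => F (Fin.cons y t)) ![x, z, w, v, u]
      + altSum (fun t => F (Fin.cons z t)) ![x, y, w, v, u]
      - altSum (fun t => F (Fin.cons w t)) ![x, y, z, v, u]
      + altSum (fun t => F (Fin.cons v t)) ![x, y, z, w, u]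
      - altSum (fun t => F (Fin.cons u t)) ![x, y, z, w, v] := by
  rw [altSum_slot]
  have h0 : (![x, y, z, w, v, u] ∘ (0 : Fin 6).succAbove) = ![y, z, w, v, u] := by
    funext i; fin_cases i <;> rfl
  have h1 : (![x, y, z, w, v, u] ∘ (1 : Fin 6).succAbove) = ![x, z, w, v, u] := by
    funext i; fin_cases i <;> rfl
  have h2 : (![x, y, z, w, v, u] ∘ (2 : Fin 6).succAbove) = ![x, y, w, v, u] := by
    funext i; fin_cases i <;> rfl
  have h3 : (![x, y, z, w, v, u] ∘ (3 : Fin 6).succAbove) = ![x, y, z, v, u] := by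
    funext i; fin_cases i <;> rfl
  have h4 : (![x, y, z, w, v, u] ∘ (4 : Fin 6).succAbove) = ![x, y, z, w, u] := by
    funext i; fin_cases i <;> rfl
  have h5 : (![x, y, z, w, v, u] ∘ (5 : Fin 6).succAbove) = ![x, y, z, w, v] := by
    funext i; fin_cases i <;> rfl
  rw [Fin.sum_univ_six, h0, h1, h2, h3, h4, h5]
  simp
  norm_num
  ring

theorem altSum_fourForm (p : W [⋀^Fin 4]→ₗ[ℝ] ℝ) (x y z w : W) :
    altSum (fun t : Fin 4 → W => p ![t 0, t 1, t 2, t 3]) ![x, y, z, w] = 24 * p ![x, y, z, w] := by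
  have := altSum_alternatingMap p ![x, y, z, w]
  norm_num [Nat.factorial] at this
  rw [← this]
  congr 1
  funext t
  exact (fourForm_eta p t).symm

theorem altSum_oneForm_fourForm (α : W → ℝ) (p : W [⋀^Fin 4]→ₗ[ℝ] ℝ) (x y z w v : W) :
    altSum (fun t : Fin 5 → W => α (t 0) * p ![t 1, t 2, t 3, t 4]) ![x, y, z, w, v] =
      24 * (α x * p ![y, z, w, v] - α y * p ![x, z, w, v] + α z * p ![x, y, w, v]
        - α w * p ![x, y, z, v] + α v * p ![x, y, z, w]) := by
  have H : ∀ c x y z w : W, altSum (fun t : Fin 4 → W => (fun t : Fin 5 → W =>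
      α (t 0) * p ![t 1, t 2, t 3, t 4]) (Fin.cons c t)) ![x, y, z, w] =
      α c * (24 * p ![x, y, z, w]) := by
    intro c x y z w
    rw [← altSum_fourForm, ← altSum_const_mul]
    rfl
  rw [altSum_five]
  simp only [H]
  ring

/-- Keeping N apart from m + n lets the general formula be used for forms whose degree is a numeral.
-/
theorem altSum_of_heq_wedge {m n N : ℕ} (h : m + n = N) (a : W [⋀^Fin m]→ₗ[ℝ] ℝ)
    (b : W [⋀^Fin n]→ₗ[ℝ] ℝ) (q : W [⋀^Fin N]→ₗ[ℝ] ℝ) (hq : q ≍ wedge a b) (y : Fin N → W) :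
    (m.factorial * n.factorial : ℝ) * q y =
      altSum (fun z : Fin N → W => a (fun i => z (Fin.cast h (Fin.castAdd n i))) *
        b (fun i => z (Fin.cast h (Fin.natAdd m i)))) y := by
  subst h
  cases hq
  exact wedge_eq_altSum a b y

theorem curryLeft_of_heq_wedge {m n N : ℕ} (h : m + n = N) (a : W [⋀^Fin m]→ₗ[ℝ] ℝ)
    (b : W [⋀^Fin (n + 1)]→ₗ[ℝ] ℝ) (u : W) (hu : ∀ (z : Fin m → W) (i : Fin m), z i = u → a z = 0)
    (q : W [⋀^Fin (N + 1)]→ₗ[ℝ] ℝ) (hq : q ≍ wedge a b)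
    (q' : W [⋀^Fin N]→ₗ[ℝ] ℝ) (hq' : q' ≍ wedge a (b.curryLeft u)) :
    q.curryLeft u = (-1 : ℝ) ^ m • q' := by
  subst h
  cases hq
  cases hq'
  ext y
  exact wedge_cons_of_annihilates a b u hu y

/-- The wedge product of a 4-form and a 2-form. -/
noncomputable def wedgeFourTwo (p : W [⋀^Fin 4]→ₗ[ℝ] ℝ) (a : W [⋀^Fin 2]→ₗ[ℝ] ℝ) :
    W [⋀^Fin 6]→ₗ[ℝ] ℝ := wedge p a

/-- The wedge product of a 4-form and a 3-form. -/
noncomputable def wedgeFourThree (p : W [⋀^Fin 4]→ₗ[ℝ] ℝ) (b : W [⋀^Fin 3]→ₗ[ℝ] ℝ) :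
    W [⋀^Fin 7]→ₗ[ℝ] ℝ := wedge p b

/-- The wedge product of two 4-forms. -/
noncomputable def wedgeFour (a b : W [⋀^Fin 4]→ₗ[ℝ] ℝ) : W [⋀^Fin 8]→ₗ[ℝ] ℝ := wedge a b

theorem wedgeFour_apply_of_annihilates (p Φ : W [⋀^Fin 4]→ₗ[ℝ] ℝ) (u v x₁ x₂ x₃ x₄ x₅ x₆ : W)
    (hu : ∀ (z : Fin 4 → W) (i : Fin 4), z i = u → p z = 0)
    (hv : ∀ (z : Fin 4 → W) (i : Fin 4), z i = v → p z = 0) :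
    wedgeFour p Φ ![u, v, x₁, x₂, x₃, x₄, x₅, x₆] =
      wedgeFourTwo p ((Φ.curryLeft u).curryLeft v) ![x₁, x₂, x₃, x₄, x₅, x₆] := by
  have e1 := curryLeft_of_heq_wedge (m := 4) (n := 3) (N := 7) rfl p Φ u hu (wedgeFour p Φ) HEq.rfl
    (wedgeFourThree p (Φ.curryLeft u)) HEq.rfl
  have e2 := curryLeft_of_heq_wedge (m := 4) (n := 2) (N := 6) rfl p (Φ.curryLeft u) v hv
    (wedgeFourThree p (Φ.curryLeft u)) HEq.rfl
    (wedgeFourTwo p ((Φ.curryLeft u).curryLeft v)) HEq.rfl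
  generalize wedgeFour p Φ = q at e1 ⊢
  generalize wedgeFourThree p (Φ.curryLeft u) = r at e1 e2
  generalize wedgeFourTwo p ((Φ.curryLeft u).curryLeft v) = s at e2 ⊢
  rw [show (-1 : ℝ) ^ 4 = 1 by norm_num, one_smul] at e1 e2
  subst e2
  subst e1
  rfl

theorem wedgeFourTwo_apply (p : W [⋀^Fin 4]→ₗ[ℝ] ℝ) (a : W [⋀^Fin 2]→ₗ[ℝ] ℝ) (x y z w v u : W) :
    wedgeFourTwo p a ![x, y, z, w, v, u] =
      a ![x, y] * p ![z, w, v, u] - a ![x, z] * p ![y, w, v, u] + a ![x, w] * p ![y, z, v, u]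
      - a ![x, v] * p ![y, z, w, u] + a ![x, u] * p ![y, z, w, v]
      + a ![y, z] * p ![x, w, v, u] - a ![y, w] * p ![x, z, v, u] + a ![y, v] * p ![x, z, w, u]
      - a ![y, u] * p ![x, z, w, v] + a ![z, w] * p ![x, y, v, u] - a ![z, v] * p ![x, y, w, u]
      + a ![z, u] * p ![x, y, w, v] + a ![w, v] * p ![x, y, z, u] - a ![w, u] * p ![x, y, z, v]
      + a ![v, u] * p ![x, y, z, w] := by
  have hs := twoForm_swap (W := W)
  have h := altSum_of_heq_wedge (m := 4) (n := 2) (N := 6) rfl p a (wedgeFourTwo p a) HEq.rfl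
    ![x, y, z, w, v, u]
  -- Rotating by four places, an even permutation, puts the two arguments of the 2-form first, so
  -- that only they need to be expanded.
  have e : (fun z : Fin 6 → W => p (fun i => z (Fin.cast rfl (Fin.castAdd 2 i))) *
      a (fun i => z (Fin.cast rfl (Fin.natAdd 4 i)))) =
      fun t => (fun t : Fin 6 → W => a ![t 0, t 1] * p ![t 2, t 3, t 4, t 5])
        (t ∘ (finRotate 6 ^ 4 : Perm (Fin 6))) := by
    funext t
    rw [fourForm_eta p, twoForm_eta a, mul_comm]
    rfl
  have h6 : (Perm.sign (finRotate 6 ^ 4 : Perm (Fin 6)) : ℤ) = 1 := by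
    rw [map_pow, sign_finRotate]; norm_num
  have h7 := altSum_comp_perm (fun t : Fin 6 → W => a ![t 0, t 1] * p ![t 2, t 3, t 4, t 5])
    (finRotate 6 ^ 4) ![x, y, z, w, v, u]
  rw [e] at h
  replace h := h.trans h7
  rw [h6, altSum_six] at h
  have H : ∀ c x y z w v : W, altSum (fun t : Fin 5 → W => (fun t : Fin 6 → W =>
      a ![t 0, t 1] * p ![t 2, t 3, t 4, t 5]) (Fin.cons c t)) ![x, y, z, w, v] =
      24 * (a ![c, x] * p ![y, z, w, v] - a ![c, y] * p ![x, z, w, v] + a ![c, z] * p ![x, y, w, v]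
        - a ![c, w] * p ![x, y, z, v] + a ![c, v] * p ![x, y, z, w]) := by
    intro c x y z w v
    exact altSum_oneForm_fourForm (fun t => a ![c, t]) p x y z w v
  simp only [H] at h
  rw [hs a x y, hs a x z, hs a x w, hs a x v, hs a x u, hs a y z, hs a y w, hs a y v, hs a y u,
    hs a z w, hs a z v, hs a z u, hs a w v, hs a w u, hs a v u] at h
  norm_num [Nat.factorial] at h
  linarith

/-- The Pfaffian of the skew-symmetric `6 × 6` matrix with entries `a (xᵢ, xⱼ)`. -/
def pfaffian₆ (a : W → W → ℝ) (x y z w v u : W) : ℝ :=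
  a x y * (a z w * a v u - a z v * a w u + a z u * a w v)
  - a x z * (a y w * a v u - a y v * a w u + a y u * a w v)
  + a x w * (a y z * a v u - a y v * a z u + a y u * a z v)
  - a x v * (a y z * a w u - a y w * a z u + a y u * a z w)
  + a x u * (a y z * a w v - a y w * a z v + a y v * a z w)

end

/-! ### Multilinearity and symmetries of the 8-form -/

section

variable {W : Type*} [AddCommGroup W] [Module ℝ W]

theorem wedge_eq_lift {m n : ℕ} (a : W [⋀^Fin m]→ₗ[ℝ] ℝ) (b : W [⋀^Fin n]→ₗ[ℝ] ℝ) :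
    wedge a b = ((LinearMap.mul' ℝ ℝ).compAlternatingMap
      (AlternatingMap.domCoprod' (a ⊗ₜ[ℝ] b))).domDomCongr finSumFinEquiv := rfl

theorem wedge_add_left {m n : ℕ} (a a' : W [⋀^Fin m]→ₗ[ℝ] ℝ) (b : W [⋀^Fin n]→ₗ[ℝ] ℝ) :
    wedge (a + a') b = wedge a b + wedge a' b := by
  simp only [wedge_eq_lift, TensorProduct.add_tmul, map_add]; ext; simp

theorem wedge_smul_left {m n : ℕ} (c : ℝ) (a : W [⋀^Fin m]→ₗ[ℝ] ℝ) (b : W [⋀^Fin n]→ₗ[ℝ] ℝ) :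
    wedge (c • a) b = c • wedge a b := by
  simp only [wedge_eq_lift, ← TensorProduct.smul_tmul', map_smul]; ext; simp

/-- The wedge product of two 2-forms. -/
noncomputable def wedgeTwo (a b : W [⋀^Fin 2]→ₗ[ℝ] ℝ) : W [⋀^Fin 4]→ₗ[ℝ] ℝ := wedge a b

theorem wedgeTwo_add_left (a a' b : W [⋀^Fin 2]→ₗ[ℝ] ℝ) :
    wedgeTwo (a + a') b = wedgeTwo a b + wedgeTwo a' b := wedge_add_left a a' b

theorem wedgeTwo_smul_left (c : ℝ) (a b : W [⋀^Fin 2]→ₗ[ℝ] ℝ) :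
    wedgeTwo (c • a) b = c • wedgeTwo a b := wedge_smul_left c a b

theorem wedgeFour_add_left (a a' b : W [⋀^Fin 4]→ₗ[ℝ] ℝ) :
    wedgeFour (a + a') b = wedgeFour a b + wedgeFour a' b := wedge_add_left a a' b

theorem wedgeFour_smul_left (c : ℝ) (a b : W [⋀^Fin 4]→ₗ[ℝ] ℝ) :
    wedgeFour (c • a) b = c • wedgeFour a b := wedge_smul_left c a b

theorem wedgeTwo_comm (a b : W [⋀^Fin 2]→ₗ[ℝ] ℝ) : wedgeTwo a b = wedgeTwo b a := by
  ext f
  have h : f = ![f 0, f 1, f 2, f 3] := by funext i; fin_cases i <;> rfl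
  rw [h]
  exact (wedge_two_two a b _ _ _ _).trans (Eq.trans (by ring) (wedge_two_two b a _ _ _ _).symm)

theorem contract₂_add_left (Φ : W [⋀^Fin 4]→ₗ[ℝ] ℝ) (u u' v : W) :
    contract₂ Φ (u + u') v = contract₂ Φ u v + contract₂ Φ u' v := by simp [contract₂]

theorem contract₂_smul_left (Φ : W [⋀^Fin 4]→ₗ[ℝ] ℝ) (c : ℝ) (u v : W) :
    contract₂ Φ (c • u) v = c • contract₂ Φ u v := by simp [contract₂]

theorem contract₂_swap (Φ : W [⋀^Fin 4]→ₗ[ℝ] ℝ) (u v : W) :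
    contract₂ Φ v u = -contract₂ Φ u v := by
  ext f
  rw [AlternatingMap.neg_apply]
  change Φ (Fin.cons v (Fin.cons u f)) = -Φ (Fin.cons u (Fin.cons v f))
  rw [← Φ.map_swap (Fin.cons u (Fin.cons v f)) (show (0 : Fin 4) ≠ 1 by decide)]
  congr 1
  funext i; fin_cases i <;> rfl

theorem eightForm_eq (Φ : W [⋀^Fin 4]→ₗ[ℝ] ℝ) (u v w x : W) :
    eightForm Φ u v w x = wedgeFour (wedgeTwo (contract₂ Φ u v) (contract₂ Φ w x)) Φ := rfl

theorem eightForm_add_left (Φ : W [⋀^Fin 4]→ₗ[ℝ] ℝ) (u u' v w x : W) :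
    eightForm Φ (u + u') v w x = eightForm Φ u v w x + eightForm Φ u' v w x := by
  simp only [eightForm_eq, contract₂_add_left, wedgeTwo_add_left, wedgeFour_add_left]

theorem eightForm_smul_left (Φ : W [⋀^Fin 4]→ₗ[ℝ] ℝ) (c : ℝ) (u v w x : W) :
    eightForm Φ (c • u) v w x = c • eightForm Φ u v w x := by
  simp only [eightForm_eq, contract₂_smul_left, wedgeTwo_smul_left, wedgeFour_smul_left]

theorem eightForm_swap (Φ : W [⋀^Fin 4]→ₗ[ℝ] ℝ) (u v w x : W) :
    eightForm Φ v u w x = -eightForm Φ u v w x := by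
  rw [eightForm_eq, contract₂_swap, ← neg_one_smul ℝ (contract₂ Φ u v), wedgeTwo_smul_left,
    wedgeFour_smul_left, neg_one_smul ℝ (wedgeFour _ _), ← eightForm_eq]

theorem eightForm_pair_symm (Φ : W [⋀^Fin 4]→ₗ[ℝ] ℝ) (u v w x : W) :
    eightForm Φ w x u v = eightForm Φ u v w x := by
  rw [eightForm_eq, wedgeTwo_comm, eightForm_eq]

/-- The values of the 8-forms `eightForm Φ u v w x` on given vectors, as a linear map in each
argument. -/
noncomputable def eightFormAt (Φ : W [⋀^Fin 4]→ₗ[ℝ] ℝ) (y : Fin 8 → W) :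
    W →ₗ[ℝ] W →ₗ[ℝ] W →ₗ[ℝ] W →ₗ[ℝ] ℝ :=
  LinearMap.mk₂ ℝ
    (fun u v => LinearMap.mk₂ ℝ (fun w x => eightForm Φ u v w x y)
      (fun w w' x => by
        rw [eightForm_pair_symm, eightForm_add_left, AlternatingMap.add_apply,
          eightForm_pair_symm Φ w, eightForm_pair_symm Φ w'])
      (fun c w x => by
        rw [eightForm_pair_symm, eightForm_smul_left, AlternatingMap.smul_apply,
          eightForm_pair_symm Φ w])
      (fun w x x' => by
        rw [← eightForm_pair_symm, ← neg_neg (eightForm Φ w _ u v), ← eightForm_swap,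
          eightForm_add_left, eightForm_swap, eightForm_swap Φ w x', ← neg_add, neg_neg,
          AlternatingMap.add_apply, eightForm_pair_symm Φ u, eightForm_pair_symm Φ u])
      (fun c w x => by
        rw [← eightForm_pair_symm, ← neg_neg (eightForm Φ w _ u v), ← eightForm_swap,
          eightForm_smul_left, eightForm_swap, smul_neg, neg_neg,
          AlternatingMap.smul_apply, eightForm_pair_symm Φ u]))
    (fun u u' v => by
      ext w x
      simp only [LinearMap.mk₂_apply, LinearMap.add_apply]
      rw [eightForm_add_left, AlternatingMap.add_apply])
    (fun c u v => by
      ext w x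
      simp only [LinearMap.mk₂_apply, LinearMap.smul_apply]
      rw [eightForm_smul_left, AlternatingMap.smul_apply])
    (fun u v v' => by
      ext w x
      simp only [LinearMap.mk₂_apply, LinearMap.add_apply]
      rw [eightForm_swap, eightForm_add_left, AlternatingMap.neg_apply, AlternatingMap.add_apply,
        eightForm_swap, eightForm_swap Φ u v', AlternatingMap.neg_apply, AlternatingMap.neg_apply]
      ring)
    (fun c u v => by
      ext w x
      simp only [LinearMap.mk₂_apply, LinearMap.smul_apply]
      rw [eightForm_swap, eightForm_smul_left, AlternatingMap.neg_apply, AlternatingMap.smul_apply,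
        eightForm_swap, AlternatingMap.neg_apply]
      simp)

theorem eightFormAt_apply (Φ : W [⋀^Fin 4]→ₗ[ℝ] ℝ) (y : Fin 8 → W) (u v w x : W) :
    eightFormAt Φ y u v w x = eightForm Φ u v w x y := by
  simp only [eightFormAt, LinearMap.mk₂_apply]

/-- A 4-form as a linear map in each of its arguments. -/
noncomputable def curried (Φ : W [⋀^Fin 4]→ₗ[ℝ] ℝ) :
    W →ₗ[ℝ] W →ₗ[ℝ] W →ₗ[ℝ] W →ₗ[ℝ] ℝ :=
  LinearMap.mk₂ ℝ (fun u v => LinearMap.mk₂ ℝ (fun w x => contract₂ Φ u v ![w, x])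
    (fun w w' x => (contract₂ Φ u v).map_vecCons_add ![x] w w')
    (fun c w x => (contract₂ Φ u v).map_vecCons_smul ![x] c w)
    (fun w x x' => by
      rw [twoForm_swap, twoForm_swap _ x w, twoForm_swap _ x' w,
        (contract₂ Φ u v).map_vecCons_add ![w] x x']
      ring)
    (fun c w x => by
      rw [twoForm_swap, twoForm_swap _ x w, (contract₂ Φ u v).map_vecCons_smul ![w] c x]
      simp))
    (fun u u' v => by ext w x; exact congrArg (fun c => c ![w, x]) (contract₂_add_left Φ u u' v))
    (fun c u v => by ext w x; exact congrArg (fun c => c ![w, x]) (contract₂_smul_left Φ c u v))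
    (fun u v v' => by
      ext w x
      exact congrArg (fun c => c ![w, x]) (show contract₂ Φ u (v + v') = contract₂ Φ u v + contract₂ Φ u v' by simp [contract₂]))
    (fun c u v => by
      ext w x
      exact congrArg (fun c => c ![w, x]) (show contract₂ Φ u (c • v) = c • contract₂ Φ u v by simp [contract₂]))

theorem curried_apply (Φ : W [⋀^Fin 4]→ₗ[ℝ] ℝ) (u v w x : W) :
    curried Φ u v w x = Φ ![u, v, w, x] := rfl

theorem curried_swap₁₂ (Φ : W [⋀^Fin 4]→ₗ[ℝ] ℝ) (u v w x : W) :
    curried Φ v u w x = -curried Φ u v w x := by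
  simp only [curried_apply]
  rw [← Φ.map_swap ![u, v, w, x] (show (0 : Fin 4) ≠ 1 by decide)]
  congr 1
  funext i; fin_cases i <;> rfl

theorem curried_swap₂₃ (Φ : W [⋀^Fin 4]→ₗ[ℝ] ℝ) (u v w x : W) :
    curried Φ u w v x = -curried Φ u v w x := by
  simp only [curried_apply]
  rw [← Φ.map_swap ![u, v, w, x] (show (1 : Fin 4) ≠ 2 by decide)]
  congr 1
  funext i; fin_cases i <;> rfl

theorem curried_swap₃₄ (Φ : W [⋀^Fin 4]→ₗ[ℝ] ℝ) (u v w x : W) :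
    curried Φ u v x w = -curried Φ u v w x := by
  simp only [curried_apply]
  rw [← Φ.map_swap ![u, v, w, x] (show (2 : Fin 4) ≠ 3 by decide)]
  congr 1
  funext i; fin_cases i <;> rfl

/-- Put ω = Φ(u,v,·,·). As u and v annihilate ω, contracting ω∧ω∧Φ with them gives ω∧ω∧ω, which is
3! times the Pfaffian of ω. -/
theorem eightForm_self_apply (Φ : W [⋀^Fin 4]→ₗ[ℝ] ℝ) (u v x₁ x₂ x₃ x₄ x₅ x₆ : W) :
    eightForm Φ u v u v ![u, v, x₁, x₂, x₃, x₄, x₅, x₆] =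
      6 * pfaffian₆ (fun s t => curried Φ u v s t) x₁ x₂ x₃ x₄ x₅ x₆ := by
  set a := contract₂ Φ u v with ha
  have hau : ∀ s, a ![u, s] = 0 := fun s => by
    have := curried_swap₂₃ Φ u v u s
    have := curried_swap₁₂ Φ u u v s
    change curried Φ u v u s = 0
    linarith
  have hav : ∀ s, a ![v, s] = 0 := fun s => by
    have := curried_swap₂₃ Φ u v v s
    change curried Φ u v v s = 0
    linarith
  have hau' : ∀ s, a ![s, u] = 0 := fun s => by rw [twoForm_swap, hau, neg_zero]
  have hav' : ∀ s, a ![s, v] = 0 := fun s => by rw [twoForm_swap, hav, neg_zero]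
  have key : ∀ s : W, (∀ t, a ![s, t] = 0) → (∀ t, a ![t, s] = 0) →
      ∀ (z : Fin 4 → W) (i : Fin 4), z i = s → wedgeTwo a a z = 0 := by
    intro s h1 h2 z i hi
    have h : z = ![z 0, z 1, z 2, z 3] := by funext i; fin_cases i <;> rfl
    rw [h]
    refine (wedge_two_two a a _ _ _ _).trans ?_
    fin_cases i <;> simp at hi <;> simp [hi, h1, h2]
  have h2 : ∀ x y z w : W, wedgeTwo a a ![x, y, z, w] = a ![x, y] * a ![z, w]
      - a ![x, z] * a ![y, w] + a ![x, w] * a ![y, z] + a ![y, z] * a ![x, w]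
      - a ![y, w] * a ![x, z] + a ![z, w] * a ![x, y] := wedge_two_two a a
  rw [eightForm_eq, ← ha]
  generalize wedgeTwo a a = p at key h2 ⊢
  refine (wedgeFour_apply_of_annihilates p Φ u v x₁ x₂ x₃ x₄ x₅ x₆ (key u hau hau')
    (key v hav hav')).trans ?_
  rw [wedgeFourTwo_apply]
  change _ = 6 * pfaffian₆ (fun s t => a ![s, t]) x₁ x₂ x₃ x₄ x₅ x₆
  simp only [h2, pfaffian₆]
  rw [show (Φ.curryLeft u).curryLeft v = a from rfl]
  ring

end

/-! ### Nondegeneracy and the constant sign of the bivector form -/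

section

variable {W : Type*} [AddCommGroup W] [Module ℝ W]

theorem linearIndependent_triple_iff {u v w : W} : LinearIndependent ℝ ![u, v, w] ↔
    ∀ a b c : ℝ, a • u + b • v + c • w = 0 → a = 0 ∧ b = 0 ∧ c = 0 := by
  rw [Fintype.linearIndependent_iff]
  constructor
  · intro h a b c habc
    have := h ![a, b, c] (by simpa [Fin.sum_univ_three] using habc)
    exact ⟨this 0, this 1, this 2⟩
  · intro h g hg
    have := h (g 0) (g 1) (g 2) (by simpa [Fin.sum_univ_three] using hg)
    intro i
    fin_cases i
    exacts [this.1, this.2.1, this.2.2]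

theorem linearIndependent_pair_iff_forall {u v : W} (hu : u ≠ 0) :
    LinearIndependent ℝ ![u, v] ↔ ∀ s : ℝ, v ≠ s • u := by
  rw [LinearIndependent.pair_iff' hu]
  exact forall_congr' fun s => ⟨fun h h' => h h'.symm, fun h h' => h h'.symm⟩

theorem linearIndependent_pair_symm {u v : W} (h : LinearIndependent ℝ ![u, v]) :
    LinearIndependent ℝ ![v, u] := LinearIndependent.pair_symm_iff.mp h

theorem exists_ne_zero_forall_eq_zero {k : ℕ} (hk : k < Module.finrank ℝ W)
    (l : Fin k → W →ₗ[ℝ] ℝ) : ∃ x : W, x ≠ 0 ∧ ∀ i, l i x = 0 := by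
  have : FiniteDimensional ℝ W := FiniteDimensional.of_finrank_pos (by omega)
  have h := LinearMap.ker_ne_bot_of_finrank_lt (f := LinearMap.pi l) (by simpa using hk)
  obtain ⟨x, hx, hx0⟩ := Submodule.exists_mem_ne_zero_of_ne_bot h
  exact ⟨x, hx0, fun i => congrFun (LinearMap.mem_ker.mp hx) i⟩

theorem exists_dual_pair {u v : W} (h : LinearIndependent ℝ ![u, v]) :
    ∃ α β : W →ₗ[ℝ] ℝ, α u = 1 ∧ α v = 0 ∧ β u = 0 ∧ β v = 1 := by
  have hk := linearIndependent_iff_injective_fintypeLinearCombination.mp h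
  obtain ⟨g, hg⟩ := LinearMap.exists_leftInverse_of_injective
    (Fintype.linearCombination ℝ ![u, v]) (LinearMap.ker_eq_bot.mpr hk)
  have h0 := LinearMap.congr_fun hg ![1, 0]
  have h1 := LinearMap.congr_fun hg ![0, 1]
  simp [Fintype.linearCombination_apply, Fin.sum_univ_two] at h0 h1
  exact ⟨LinearMap.proj 0 ∘ₗ g, LinearMap.proj 1 ∘ₗ g, by simp [h0], by simp [h1], by simp [h0],
    by simp [h1]⟩

theorem exists_notMem_span_pair (hW : 2 < Module.finrank ℝ W) (u v : W) :
    ∃ x : W, ∀ s t : ℝ, x ≠ s • u + t • v := by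
  classical
  have h : Submodule.span ℝ {u, v} ≠ ⊤ := by
    intro h
    have h1 : Module.finrank ℝ (Submodule.span ℝ (({u, v} : Finset W) : Set W)) ≤ 2 :=
      (finrank_span_finset_le_card _).trans Finset.card_le_two
    rw [Finset.coe_pair, h, finrank_top] at h1
    omega
  obtain ⟨x, -, hx⟩ := SetLike.exists_of_lt (lt_top_iff_ne_top.mpr h)
  refine ⟨x, fun s t hst => hx ?_⟩
  rw [Submodule.mem_span_pair]
  exact ⟨s, t, hst.symm⟩

/-- Symplectic Gram–Schmidt: nondegeneracy says exactly that ω has no kernel beyond the span of u,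
v. -/
theorem Nondegenerate.exists_pfaffian_eq_one (hW : Module.finrank ℝ W = 8) {Φ : W [⋀^Fin 4]→ₗ[ℝ] ℝ}
    (hΦ : Nondegenerate Φ) {u v : W} (h : LinearIndependent ℝ ![u, v]) :
    ∃ x₁ x₂ x₃ x₄ x₅ x₆ : W, pfaffian₆ (fun s t => curried Φ u v s t) x₁ x₂ x₃ x₄ x₅ x₆ = 1 := by
  obtain ⟨α, β, αu, αv, βu, βv⟩ := exists_dual_pair h
  set ω := curried Φ u v with hω
  have sk : ∀ s t, ω t s = -ω s t := fun s t => curried_swap₃₄ Φ u v s t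
  have self : ∀ s, ω s s = 0 := fun s => by have := sk s s; linarith
  have partner : ∀ x : W, x ≠ 0 → α x = 0 → β x = 0 → ∃ y, ω x y = 1 := by
    intro x hx hα hβ
    have hli : LinearIndependent ℝ ![u, v, x] := by
      rw [linearIndependent_triple_iff]
      intro a b c habc
      have h1 := congrArg α habc
      have h2 := congrArg β habc
      simp [αu, αv, hα] at h1
      simp [βu, βv, hβ] at h2
      subst h1 h2
      simpa [hx] using habc
    obtain ⟨y, hy⟩ := hΦ u v x hli
    change ω x y ≠ 0 at hy
    exact ⟨(ω x y)⁻¹ • y, by simp [hy]⟩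
  -- The common kernel of α, β is a complement of the span of u, v. The partners yᵢ need no
  -- orthogonality: x₃ pairs only with y₃, after which x₂ pairs only with y₂.
  obtain ⟨x₁, h1, z1⟩ := exists_ne_zero_forall_eq_zero (by omega) ![α, β]
  obtain ⟨y₁, e1⟩ := partner x₁ h1 (z1 0) (z1 1)
  obtain ⟨x₂, h2, z2⟩ := exists_ne_zero_forall_eq_zero (by omega) ![α, β, ω x₁, ω y₁]
  obtain ⟨y₂, e2⟩ := partner x₂ h2 (z2 0) (z2 1)
  obtain ⟨x₃, h3, z3⟩ := exists_ne_zero_forall_eq_zero (by omega) ![α, β, ω x₁, ω y₁, ω x₂, ω y₂]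
  obtain ⟨y₃, e3⟩ := partner x₃ h3 (z3 0) (z3 1)
  have a1 : ω x₁ x₂ = 0 := z2 2
  have a2 : ω y₁ x₂ = 0 := z2 3
  have a3 : ω x₁ x₃ = 0 := z3 2
  have a4 : ω y₁ x₃ = 0 := z3 3
  have a5 : ω x₂ x₃ = 0 := z3 4
  have a6 : ω y₂ x₃ = 0 := z3 5
  refine ⟨x₁, y₁, x₂, y₂, x₃, y₃, ?_⟩
  simp only [pfaffian₆, a1, a2, a3, a4, a5, a6, e1, e2, e3]
  ring

theorem Nondegenerate.eightForm_ne_zero (hW : Module.finrank ℝ W = 8) {Φ : W [⋀^Fin 4]→ₗ[ℝ] ℝ}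
    (hΦ : Nondegenerate Φ) {u v : W} (h : LinearIndependent ℝ ![u, v]) :
    eightForm Φ u v u v ≠ 0 := by
  obtain ⟨x₁, x₂, x₃, x₄, x₅, x₆, hx⟩ := hΦ.exists_pfaffian_eq_one hW h
  intro h0
  have := eightForm_self_apply Φ u v x₁ x₂ x₃ x₄ x₅ x₆
  rw [hx, h0] at this
  norm_num at this

theorem eightForm_eq_zero_iff (e : Module.Basis (Fin 8) ℝ W) (Φ : W [⋀^Fin 4]→ₗ[ℝ] ℝ) (u v w x : W) :
    eightForm Φ u v w x = 0 ↔ eightFormAt Φ e u v w x = 0 := by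
  rw [eightFormAt_apply]
  constructor
  · intro h
    rw [h, AlternatingMap.zero_apply]
  · intro h
    rw [(eightForm Φ u v w x).eq_smul_basis_det e, h, zero_smul]

/-- The symmetries of the pairing `(u ∧ v, w ∧ x) ↦ R u v w x` induced by a symmetric bilinear form
on bivectors. -/
structure IsBivectorForm (R : W →ₗ[ℝ] W →ₗ[ℝ] W →ₗ[ℝ] W →ₗ[ℝ] ℝ) : Prop where
  swap : ∀ u v w x, R v u w x = -R u v w x
  pair_symm : ∀ u v w x, R w x u v = R u v w x

theorem isBivectorForm_eightFormAt (Φ : W [⋀^Fin 4]→ₗ[ℝ] ℝ) (y : Fin 8 → W) :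
    IsBivectorForm (eightFormAt Φ y) where
  swap u v w x := by
    simp only [eightFormAt_apply, eightForm_swap Φ u v, AlternatingMap.neg_apply]
  pair_symm u v w x := by
    simp only [eightFormAt_apply, eightForm_pair_symm]

namespace IsBivectorForm

variable {R : W →ₗ[ℝ] W →ₗ[ℝ] W →ₗ[ℝ] W →ₗ[ℝ] ℝ}

theorem swap' (h : IsBivectorForm R) (u v w x : W) : R u v x w = -R u v w x := by
  rw [h.pair_symm, h.swap, h.pair_symm]

theorem self (h : IsBivectorForm R) (u w x : W) : R u u w x = 0 := by
  have := h.swap u u w x; linarith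

theorem self' (h : IsBivectorForm R) (u w x : W) : R u w x x = 0 := by
  have := h.swap' u w x x; linarith

theorem section_symm (h : IsBivectorForm R) (u v : W) : R v u v u = R u v u v := by
  rw [h.swap, h.swap', neg_neg]

/-- If the quadratic form R(u,·,u,·) changed sign between v and v', it would have two distinct zeros
on the line v + t v'. Both zeros are multiples of u by `hne`, and then so is v'. -/
theorem pos_of_pos_of_ne_zero (h : IsBivectorForm R)
    (hne : ∀ u v, LinearIndependent ℝ ![u, v] → R u v u v ≠ 0) {u v v' : W}
    (hv : LinearIndependent ℝ ![u, v]) (hv' : LinearIndependent ℝ ![u, v'])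
    (hpos : 0 < R u v u v) : 0 < R u v' u v' := by
  have hu : u ≠ 0 := hv.ne_zero 0
  by_contra hneg
  have hneg : R u v' u v' < 0 := lt_of_le_of_ne (not_lt.mp hneg) (hne u v' hv')
  set A := R u v u v
  set B := R u v u v'
  set C := R u v' u v'
  have hp : ∀ t : ℝ, R u (v + t • v') u (v + t • v') = A + 2 * B * t + C * t ^ 2 := by
    intro t
    have := h.pair_symm u v u v'
    simp only [map_add, map_smul, LinearMap.add_apply, LinearMap.smul_apply, smul_eq_mul, A, B, C]
    rw [this]
    ring
  have hD : 0 < B ^ 2 - A * C := by nlinarith [sq_nonneg B, mul_pos hpos (neg_pos.mpr hneg)]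
  have hC : C ≠ 0 := hneg.ne
  set r := Real.sqrt (B ^ 2 - A * C)
  have hr : 0 < r := Real.sqrt_pos.mpr hD
  have hr2 : r ^ 2 = B ^ 2 - A * C := Real.sq_sqrt hD.le
  have root : ∀ q : ℝ, q ^ 2 = r ^ 2 → ∃ s : ℝ, v + ((-B + q) / C) • v' = s • u := by
    intro q hq
    have h0 : R u (v + ((-B + q) / C) • v') u (v + ((-B + q) / C) • v') = 0 := by
      rw [hp]
      field_simp
      rw [hr2] at hq
      linear_combination hq
    by_contra hs
    push Not at hs
    exact hne _ _ ((linearIndependent_pair_iff_forall hu).mpr hs) h0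
  obtain ⟨s₁, h1⟩ := root r rfl
  obtain ⟨s₂, h2⟩ := root (-r) (by ring)
  have h3 : v' = ((s₁ - s₂) * (C / (2 * r))) • u := by
    have h4 : (2 * r / C) • v' = (s₁ - s₂) • u := by
      rw [sub_smul, ← h1, ← h2]
      module
    have h5 : (C / (2 * r)) * (2 * r / C) = 1 := by field_simp
    rw [mul_comm, mul_smul, ← h4, smul_smul, h5, one_smul]
  exact (linearIndependent_pair_iff_forall hu).mp hv' _ h3

/-- A vector w outside the span of u, u' links the pairs: positivity passes from (u,v) to (u,w), to
(u',w), to (u',v'), one vector being changed at a time. -/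
theorem pos_or_neg (h : IsBivectorForm R) (hW : 2 < Module.finrank ℝ W)
    (hne : ∀ u v, LinearIndependent ℝ ![u, v] → R u v u v ≠ 0) :
    (∀ u v, LinearIndependent ℝ ![u, v] → 0 < R u v u v) ∨
      ∀ u v, LinearIndependent ℝ ![u, v] → R u v u v < 0 := by
  by_cases hex : ∃ u v, LinearIndependent ℝ ![u, v] ∧ 0 < R u v u v
  · left
    obtain ⟨u, v, hli, hpos⟩ := hex
    intro u' v' hli'
    have hu : u ≠ 0 := hli.ne_zero 0
    have hu' : u' ≠ 0 := hli'.ne_zero 0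
    obtain ⟨w, hw⟩ := exists_notMem_span_pair hW u u'
    have l1 : LinearIndependent ℝ ![u, w] :=
      (linearIndependent_pair_iff_forall hu).mpr fun s hs => hw s 0 (by simpa using hs)
    have l2 : LinearIndependent ℝ ![u', w] :=
      (linearIndependent_pair_iff_forall hu').mpr fun s hs => hw 0 s (by simpa using hs)
    have p1 := h.pos_of_pos_of_ne_zero hne hli l1 hpos
    rw [← h.section_symm] at p1
    have p2 := h.pos_of_pos_of_ne_zero hne (linearIndependent_pair_symm l1)
      (linearIndependent_pair_symm l2) p1
    rw [h.section_symm] at p2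
    exact h.pos_of_pos_of_ne_zero hne l2 hli' p2
  · right
    push Not at hex
    exact fun u v hli => lt_of_le_of_ne (hex u v hli) (hne u v hli)

end IsBivectorForm
end

/-! ### Reconstruction of the metric from the bivector form -/

section

variable {W : Type*} [AddCommGroup W] [Module ℝ W]

/-- The inclusion of kernels gives q(w,·) = λ(w) p(w,·). Symmetry yields λ(w) = λ(y) when p(w,y) ≠
0; orthogonal w, y are compared through w + y. -/
theorem exists_proportional (p q : LinearMap.BilinForm ℝ W) (hp : ∀ x y, p x y = p y x)
    (hq : ∀ x y, q x y = q y x) (U : Submodule ℝ W) (hpos : ∀ w ∈ U, w ≠ 0 → 0 < p w w)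
    (h : ∀ w ∈ U, ∀ x, p w x = 0 → q w x = 0) :
    ∃ μ : ℝ, ∀ w ∈ U, ∀ x, q w x = μ * p w x := by
  have h1 : ∀ w ∈ U, w ≠ 0 → ∀ x, q w x = q w w / p w w * p w x := by
    intro w hw hw0 x
    have hne := (hpos w hw hw0).ne'
    have := h w hw (x - (p w x / p w w) • w) (by simp [hne])
    simp only [map_sub, map_smul, smul_eq_mul] at this
    rw [eq_of_sub_eq_zero this]
    ring
  have h2 : ∀ w ∈ U, w ≠ 0 → ∀ y ∈ U, y ≠ 0 → p w y ≠ 0 → q w w / p w w = q y y / p y y := by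
    intro w hw hw0 y hy hy0 hwy
    have e1 := h1 w hw hw0 y
    have e2 := h1 y hy hy0 w
    rw [hq, hp y w, e1] at e2
    exact mul_right_cancel₀ hwy e2
  have h3 : ∀ w ∈ U, w ≠ 0 → ∀ y ∈ U, y ≠ 0 → q w w / p w w = q y y / p y y := by
    intro w hw hw0 y hy hy0
    by_cases hwy : p w y = 0
    · have pw := (hpos w hw hw0).ne'
      have py := (hpos y hy hy0).ne'
      have hz : w + y ≠ 0 := by
        intro hz
        have := congrArg (p w) hz
        simp [hwy, pw] at this
      rw [h2 w hw hw0 (w + y) (U.add_mem hw hy) hz (by simpa [hwy] using pw),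
        h2 y hy hy0 (w + y) (U.add_mem hw hy) hz (by simpa [hp y w, hwy] using py)]
    · exact h2 w hw hw0 y hy hy0 hwy
  by_cases hU : ∃ w ∈ U, w ≠ 0
  · obtain ⟨w₀, hw₀, hne⟩ := hU
    refine ⟨q w₀ w₀ / p w₀ w₀, fun w hw x => ?_⟩
    by_cases hw0 : w = 0
    · simp [hw0]
    · rw [h1 w hw hw0 x, h3 w hw hw0 w₀ hw₀ hne]
  · push Not at hU
    exact ⟨0, fun w hw x => by simp [hU w hw]⟩

/-- A positive form on bivectors satisfying the linear-algebraic part of condition (C). -/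
structure IsConformalBivectorForm (R : W →ₗ[ℝ] W →ₗ[ℝ] W →ₗ[ℝ] W →ₗ[ℝ] ℝ) : Prop
    extends IsBivectorForm R where
  pos : ∀ u v, LinearIndependent ℝ ![u, v] → 0 < R u v u v
  cond : ∀ u v w, LinearIndependent ℝ ![u, v, w] → R u v u w = 0 → R v u v w = 0 →
    ∀ x, R u w u x = 0 ↔ R v w v x = 0

namespace IsConformalBivectorForm

variable {R : W →ₗ[ℝ] W →ₗ[ℝ] W →ₗ[ℝ] W →ₗ[ℝ] ℝ}

/-- The vectors normal to both `a` and `b`, as seen by `R`. -/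
def normalSpace (R : W →ₗ[ℝ] W →ₗ[ℝ] W →ₗ[ℝ] W →ₗ[ℝ] ℝ) (a b : W) : Submodule ℝ W :=
  LinearMap.ker (R a b a) ⊓ LinearMap.ker (R b a b)

theorem mem_normalSpace {a b w : W} :
    w ∈ normalSpace R a b ↔ R a b a w = 0 ∧ R b a b w = 0 := by
  simp [normalSpace]

theorem linearIndependent_of_mem_normalSpace (h : IsConformalBivectorForm R) {a b w : W}
    (hab : LinearIndependent ℝ ![a, b]) (hw : w ∈ normalSpace R a b) (hw0 : w ≠ 0) :
    LinearIndependent ℝ ![a, b, w] := by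
  rw [mem_normalSpace] at hw
  rw [linearIndependent_triple_iff]
  intro α β γ he
  have p1 := (h.pos a b hab).ne'
  have p2 := (h.pos b a (linearIndependent_pair_symm hab)).ne'
  have e1 := congrArg (R a b a) he
  have e2 := congrArg (R b a b) he
  simp [hw.1, h.self', p1] at e1
  simp [hw.2, h.self', p2] at e2
  subst e1 e2
  simpa [hw0] using he

theorem pos_of_mem_normalSpace (h : IsConformalBivectorForm R) {a b w : W}
    (hab : LinearIndependent ℝ ![a, b]) (hw : w ∈ normalSpace R a b) (hw0 : w ≠ 0) :
    0 < R a w a w := by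
  refine h.pos a w ?_
  have := linearIndependent_triple_iff.mp (h.linearIndependent_of_mem_normalSpace hab hw hw0)
  rw [LinearIndependent.pair_iff]
  intro s t hst
  have := this s 0 t (by simpa using hst)
  exact ⟨this.1, this.2.2⟩

theorem section_section_symm (h : IsConformalBivectorForm R) (a w x : W) :
    R a w a x = R a x a w := h.pair_symm _ _ _ _

/-- Morally μ = |b|²/|a|², since R(a,w,a,x) should be |a|²⟨w,x⟩ for w orthogonal to a. This is where
condition (C) enters. -/
theorem exists_ratio (h : IsConformalBivectorForm R) (hW : Module.finrank ℝ W = 8) {a b : W}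
    (hab : LinearIndependent ℝ ![a, b]) :
    ∃ μ : ℝ, 0 < μ ∧ ∀ w ∈ normalSpace R a b, ∀ x, R b w b x = μ * R a w a x := by
  obtain ⟨μ, hμ⟩ := exists_proportional ((R a).flip a) ((R b).flip b)
    (fun x y => h.section_section_symm a x y) (fun x y => h.section_section_symm b x y)
    (normalSpace R a b) (fun w hw hw0 => h.pos_of_mem_normalSpace hab hw hw0) (by
      intro w hw x hx
      by_cases hw0 : w = 0
      · simp [hw0]
      · have hw' := mem_normalSpace.mp hw
        exact (h.cond a b w (h.linearIndependent_of_mem_normalSpace hab hw hw0) hw'.1 hw'.2 x).mp hx)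
  refine ⟨μ, ?_, hμ⟩
  obtain ⟨w, hw0, hw⟩ := exists_ne_zero_forall_eq_zero (by omega) ![R a b a, R b a b]
  have hw1 : w ∈ normalSpace R a b := mem_normalSpace.mpr ⟨hw 0, hw 1⟩
  have hw2 : w ∈ normalSpace R b a := mem_normalSpace.mpr ⟨hw 1, hw 0⟩
  have p1 := h.pos_of_mem_normalSpace hab hw1 hw0
  have p2 := h.pos_of_mem_normalSpace (linearIndependent_pair_symm hab) hw2 hw0
  have := hμ w hw1 w
  simp only [LinearMap.flip_apply] at this
  rw [this] at p2
  exact pos_of_mul_pos_left p2 p1.le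

/-- `f` is a conformal factor for `R`: morally, `f a = |a|²`. -/
structure IsConformalFactor (R : W →ₗ[ℝ] W →ₗ[ℝ] W →ₗ[ℝ] W →ₗ[ℝ] ℝ) (f : W → ℝ) : Prop where
  pos : ∀ b, b ≠ 0 → 0 < f b
  zero : f 0 = 0
  ratio : ∀ a b, LinearIndependent ℝ ![a, b] → ∀ w ∈ normalSpace R a b, ∀ x,
    f a * R b w b x = f b * R a w a x

/-- Take f(b) to be the ratio of b to a reference vector a₀. Multiples t a₀ are not independent of
a₀ and receive the value t² by hand. -/
theorem exists_isConformalFactor (h : IsConformalBivectorForm R) (hW : Module.finrank ℝ W = 8) :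
    ∃ f : W → ℝ, IsConformalFactor R f := by
  obtain ⟨a₀, h₀, -⟩ := exists_ne_zero_forall_eq_zero (W := W) (k := 0) (by omega) ![]
  have key : ∀ b : W, ∃ m : ℝ, (b ≠ 0 → 0 < m) ∧ (∀ t : ℝ, b = t • a₀ → m = t ^ 2) ∧
      (LinearIndependent ℝ ![a₀, b] → ∀ w ∈ normalSpace R a₀ b, ∀ x,
        R b w b x = m * R a₀ w a₀ x) := by
    intro b
    by_cases hb : LinearIndependent ℝ ![a₀, b]
    · obtain ⟨μ, hμ, hr⟩ := h.exists_ratio hW hb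
      exact ⟨μ, fun _ => hμ, fun t ht => absurd ht ((linearIndependent_pair_iff_forall h₀).mp hb t),
        fun _ => hr⟩
    · have := hb
      rw [linearIndependent_pair_iff_forall h₀] at this
      push Not at this
      obtain ⟨s, hs⟩ := this
      refine ⟨s ^ 2, fun hb0 => ?_, fun t ht => ?_, fun h => absurd h hb⟩
      · have : s ≠ 0 := by
          rintro rfl
          simp [hs] at hb0
        positivity
      · rw [hs] at ht
        rw [smul_left_injective ℝ h₀ ht]
  choose f hpos hsq hrat using key
  refine ⟨f, hpos, by simpa using hsq 0 0 (by simp), ?_⟩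
  intro a b hab w hw x
  have ha : a ≠ 0 := hab.ne_zero 0
  have hb : b ≠ 0 := hab.ne_zero 1
  rw [mem_normalSpace] at hw
  by_cases hla : LinearIndependent ℝ ![a₀, a]
  · by_cases hlb : LinearIndependent ℝ ![a₀, b]
    · obtain ⟨μ, -, hr⟩ := h.exists_ratio hW hab
      -- Six linear conditions in dimension 8 leave a nonzero v normal to all three pairs; comparing
      -- the three ratios on it gives multiplicativity.
      obtain ⟨v, hv0, hv⟩ := exists_ne_zero_forall_eq_zero (by omega)
        ![R a₀ a a₀, R a a₀ a, R a₀ b a₀, R b a₀ b, R a b a, R b a b]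
      have m1 : v ∈ normalSpace R a₀ a := mem_normalSpace.mpr ⟨hv 0, hv 1⟩
      have m2 : v ∈ normalSpace R a₀ b := mem_normalSpace.mpr ⟨hv 2, hv 3⟩
      have m3 : v ∈ normalSpace R a b := mem_normalSpace.mpr ⟨hv 4, hv 5⟩
      have p0 := h.pos_of_mem_normalSpace hla m1 hv0
      have e1 := hrat a hla v m1 v
      have e2 := hrat b hlb v m2 v
      have e3 := hr v m3 v
      have e4 : f b = μ * f a := by
        apply mul_right_cancel₀ p0.ne'
        rw [← e2, e3, e1]; ring
      rw [hr w (mem_normalSpace.mpr hw) x, e4]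
      ring
    · rw [linearIndependent_pair_iff_forall h₀] at hlb
      push Not at hlb
      obtain ⟨t, rfl⟩ := hlb
      have ht : t ≠ 0 := by rintro rfl; simp at hb
      have m1 : w ∈ normalSpace R a₀ a := by
        rw [mem_normalSpace]
        have := hw.1
        have h2 := hw.2
        simp [ht] at this h2
        exact ⟨h2, this⟩
      rw [hrat a hla w m1 x, hsq _ t rfl]
      simp
      ring
  · rw [linearIndependent_pair_iff_forall h₀] at hla
    push Not at hla
    obtain ⟨t, rfl⟩ := hla
    have ht : t ≠ 0 := by rintro rfl; simp at ha
    have hlb : LinearIndependent ℝ ![a₀, b] := by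
      rw [linearIndependent_pair_iff_forall h₀]
      rw [linearIndependent_pair_iff_forall ha] at hab
      intro s hs
      exact hab (s * t⁻¹) (by rw [smul_smul, mul_assoc, inv_mul_cancel₀ ht, mul_one, hs])
    have m1 : w ∈ normalSpace R a₀ b := by
      rw [mem_normalSpace]
      have := hw.1
      have h2 := hw.2
      simp [ht] at this h2
      exact ⟨this, h2⟩
    rw [hrat b hlb w m1 x, hsq _ t rfl]
    simp
    ring

theorem IsConformalFactor.map_smul {f : W → ℝ} (hf : IsConformalFactor R f)
    (h : IsConformalBivectorForm R) (hW : Module.finrank ℝ W = 8) (t : ℝ) (b : W) :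
    f (t • b) = t ^ 2 * f b := by
  by_cases ht : t = 0
  · simp [ht, hf.zero]
  by_cases hb : b = 0
  · simp [hb, hf.zero]
  obtain ⟨a, ha⟩ := exists_notMem_span_pair (by omega) b b
  have hba : LinearIndependent ℝ ![b, a] := (linearIndependent_pair_iff_forall hb).mpr
    fun s hs => ha s 0 (by simpa using hs)
  have hba' : LinearIndependent ℝ ![t • b, a] :=
    (linearIndependent_pair_iff_forall (smul_ne_zero ht hb)).mpr
      fun s hs => ha (s * t) 0 (by simpa [mul_smul] using hs)
  obtain ⟨w, hw0, hw⟩ := exists_ne_zero_forall_eq_zero (by omega) ![R b a b, R a b a]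
  have m1 : w ∈ normalSpace R b a := mem_normalSpace.mpr ⟨hw 0, hw 1⟩
  have m2 : w ∈ normalSpace R (t • b) a := by
    have e0 : R b a b w = 0 := hw 0
    have e1 : R a b a w = 0 := hw 1
    exact mem_normalSpace.mpr ⟨by simp [e0], by simp [e1]⟩
  have m3 : w ∈ normalSpace R a b := mem_normalSpace.mpr ⟨hw 1, hw 0⟩
  have e1 := hf.ratio _ _ hba w m1 w
  have e2 := hf.ratio _ _ hba' w m2 w
  have p := h.pos_of_mem_normalSpace (linearIndependent_pair_symm hba) m3 hw0
  simp at e2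
  apply mul_right_cancel₀ p.ne'
  rw [e2]
  linear_combination (-t ^ 2) * e1

/-- With a outside the plane of b, b' and one w normal to a and every vector z of that plane, f(z)
is a fixed multiple of R(z,w,z,w), hence quadratic in z. -/
theorem IsConformalFactor.exists_companion {f : W → ℝ} (hf : IsConformalFactor R f)
    (h : IsConformalBivectorForm R) (hW : Module.finrank ℝ W = 8) (b b' : W) :
    ∃ c : ℝ, ∀ s t : ℝ, f (s • b + t • b') = s ^ 2 * f b + s * t * c + t ^ 2 * f b' := by
  by_cases hb : b = 0
  · refine ⟨0, fun s t => ?_⟩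
    simp [hb, hf.zero, hf.map_smul h hW]
  by_cases hbb : LinearIndependent ℝ ![b, b']
  · obtain ⟨a, ha⟩ := exists_notMem_span_pair (by omega) b b'
    have hba : LinearIndependent ℝ ![b, a] := (linearIndependent_pair_iff_forall hb).mpr
      fun s hs => ha s 0 (by simpa using hs)
    have hab := linearIndependent_pair_symm hba
    -- The last three conditions are the coefficients of s², t² and st in R(z,a,z,w) for z = s b + t
    -- b'.
    obtain ⟨w, hw0, hw⟩ := exists_ne_zero_forall_eq_zero (by omega)
      ![R a b a, R a b' a, R b a b, R b' a b', R b a b' + R b' a b]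
    have e0 : R a b a w = 0 := hw 0
    have e1 : R a b' a w = 0 := hw 1
    have e2 : R b a b w = 0 := hw 2
    have e3 : R b' a b' w = 0 := hw 3
    have e4 : R b a b' w + R b' a b w = 0 := hw 4
    have p := h.pos_of_mem_normalSpace hab (mem_normalSpace.mpr ⟨e0, e2⟩) hw0
    refine ⟨2 * f a * R b w b' w / R a w a w, fun s t => ?_⟩
    have main : ∀ s t : ℝ, s • b + t • b' ≠ 0 →
        f a * R (s • b + t • b') w (s • b + t • b') w = f (s • b + t • b') * R a w a w := by
      intro s t hst
      have hl : LinearIndependent ℝ ![a, s • b + t • b'] := by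
        refine linearIndependent_pair_symm ((linearIndependent_pair_iff_forall hst).mpr ?_)
        intro r hr
        exact ha (r * s) (r * t) (by rw [hr]; module)
      refine hf.ratio _ _ hl w (mem_normalSpace.mpr ⟨?_, ?_⟩) w
      · simp [e0, e1]
      · simp only [map_add, _root_.map_smul, LinearMap.add_apply, LinearMap.smul_apply, smul_eq_mul]
        linear_combination s ^ 2 * e2 + t ^ 2 * e3 + s * t * e4
    have hexp : ∀ s t : ℝ, R (s • b + t • b') w (s • b + t • b') w =
        s ^ 2 * R b w b w + 2 * s * t * R b w b' w + t ^ 2 * R b' w b' w := by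
      intro s t
      simp only [map_add, _root_.map_smul, LinearMap.add_apply, LinearMap.smul_apply, smul_eq_mul]
      rw [h.pair_symm b w b' w]
      ring
    by_cases hst : s • b + t • b' = 0
    · have := LinearIndependent.pair_iff.mp hbb s t hst
      rw [hst, this.1, this.2, hf.zero]
      ring
    · have m := main s t hst
      have mb := main 1 0 (by simpa using hb)
      have mb' := main 0 1 (by simpa using hbb.ne_zero 1)
      rw [hexp] at m mb mb'
      simp only [one_smul, zero_smul, add_zero, zero_add] at mb mb'
      field_simp
      linear_combination (-1) * m + s ^ 2 * mb + t ^ 2 * mb'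
  · rw [linearIndependent_pair_iff_forall hb] at hbb
    push Not at hbb
    obtain ⟨r, rfl⟩ := hbb
    refine ⟨2 * r * f b, fun s t => ?_⟩
    rw [show s • b + t • r • b = (s + t * r) • b by module, hf.map_smul h hW, hf.map_smul h hW]
    ring

/-- Jordan–von Neumann: the quadratic formula on planes gives the parallelogram law, and also real
homogeneity of the polarisation without any continuity argument. -/
theorem IsConformalFactor.exists_bilinForm {f : W → ℝ} (hf : IsConformalFactor R f)
    (h : IsConformalBivectorForm R) (hW : Module.finrank ℝ W = 8) :
    ∃ g : LinearMap.BilinForm ℝ W, (∀ x y, g x y = g y x) ∧ ∀ x, g x x = f x := by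
  have P : ∀ x y, f (x + y) + f (x - y) = 2 * f x + 2 * f y := by
    intro x y
    obtain ⟨c, hc⟩ := hf.exists_companion h hW x y
    have h1 := hc 1 1
    have h2 := hc 1 (-1)
    simp only [one_smul, neg_smul, ← sub_eq_add_neg] at h1 h2
    rw [h1, h2]; ring
  have A : ∀ x y z, f (x + y + z) + f x + f y + f z = f (x + y) + f (y + z) + f (x + z) := by
    intro x y z
    have h1 := P (x + z) y
    have h2 := P x (y - z)
    have h3 := P (x + y) z
    have h4 := P y z
    rw [show x + z + y = x + y + z by abel] at h1
    rw [show x + (y - z) = x + y - z by abel, show x - (y - z) = x + z - y by abel] at h2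
    linarith
  have S : ∀ (t : ℝ) (x y : W), f (t • x + y) - f (t • x) - f y = t * (f (x + y) - f x - f y) := by
    intro t x y
    obtain ⟨c, hc⟩ := hf.exists_companion h hW x y
    have h1 := hc t 1
    have h2 := hc 1 1
    simp only [one_smul] at h1 h2
    rw [h1, h2, hf.map_smul h hW]; ring
  refine ⟨LinearMap.mk₂ ℝ (fun x y => (f (x + y) - f x - f y) / 2) ?_ ?_ ?_ ?_, ?_, ?_⟩
  · intro x y z
    have := A x y z
    linarith
  · intro t x y
    have := S t x y
    simp only [smul_eq_mul]
    linarith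
  · intro x y z
    have := A x y z
    rw [← add_assoc]
    linarith
  · intro t x y
    have := S t y x
    rw [add_comm (t • y), add_comm y] at this
    simp only [smul_eq_mul]
    linarith
  · intro x y
    simp only [LinearMap.mk₂_apply]
    rw [add_comm]; ring
  · intro x
    simp only [LinearMap.mk₂_apply]
    rw [← two_smul ℝ x, hf.map_smul h hW]; ring

section Metric

variable {g : LinearMap.BilinForm ℝ W}

/-- A vector normal to a, b is also normal to a, a + b; the two ratio identities differ by this
cross term. -/
theorem metric_mul_section (h : IsConformalBivectorForm R) (hg : IsInnerProduct g)
    (hf : IsConformalFactor R (fun x => g x x)) {a b w : W} (hab : LinearIndependent ℝ ![a, b])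
    (hw : w ∈ normalSpace R a b) : g a a * R a w b w = g a b * R a w a w := by
  have ha : a ≠ 0 := hab.ne_zero 0
  have hl : LinearIndependent ℝ ![a, a + b] := by
    rw [linearIndependent_pair_iff_forall ha] at hab ⊢
    intro s hs
    exact hab (s - 1) (by rw [sub_smul, ← hs]; simp)
  have e1 := hf.ratio _ _ hab w hw w
  rw [mem_normalSpace] at hw
  have hw' : w ∈ normalSpace R a (a + b) := by
    rw [mem_normalSpace]
    constructor
    · simp [h.self, hw.1]
    · simp [h.self, hw.2, h.swap a b a w, hw.1]
  have e2 := hf.ratio _ _ hl w hw' w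
  simp only [map_add, LinearMap.add_apply] at e2
  rw [h.pair_symm a w b w, hg.symm b a] at e2
  linarith

/-- With g(a,b) = 0 the previous identity gives R(a,w,b,w) = 0, so b is normal to a, w. Applying the
identity again with b and w exchanged gives g(a,w) R(a,b,a,b) = 0. -/
theorem metric_eq_zero_of_mem_normalSpace (h : IsConformalBivectorForm R) (hg : IsInnerProduct g)
    (hf : IsConformalFactor R (fun x => g x x)) {a b w : W} (hab : LinearIndependent ℝ ![a, b])
    (hgab : g a b = 0) (hw : w ∈ normalSpace R a b) : g a w = 0 := by
  by_cases hw0 : w = 0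
  · simp [hw0]
  have ha : a ≠ 0 := hab.ne_zero 0
  have hli := h.linearIndependent_of_mem_normalSpace hab hw hw0
  have haw : LinearIndependent ℝ ![a, w] := by
    rw [linearIndependent_triple_iff] at hli
    rw [LinearIndependent.pair_iff]
    intro s t hst
    have := hli s 0 t (by simpa using hst)
    exact ⟨this.1, this.2.2⟩
  have e1 := h.metric_mul_section hg hf hab hw
  rw [hgab, zero_mul] at e1
  have e2 : R a w b w = 0 := (mul_eq_zero.mp e1).resolve_left (hg.pos a ha).ne'
  rw [mem_normalSpace] at hw
  have hb : b ∈ normalSpace R a w := by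
    rw [mem_normalSpace]
    constructor
    · rw [h.section_section_symm, hw.1]
    · rw [h.swap, h.swap', e2]; simp
  have e3 := h.metric_mul_section hg hf haw hb
  have e4 : R a b w b = 0 := by rw [h.swap, h.swap', hw.2]; simp
  rw [e4, mul_zero] at e3
  exact (mul_eq_zero.mp e3.symm).resolve_right (h.pos a b hab).ne'

theorem linearIndependent_of_orthogonal (hg : IsInnerProduct g) {a b : W} (ha : a ≠ 0) (hb : b ≠ 0)
    (hab : g a b = 0) : LinearIndependent ℝ ![a, b] := by
  rw [linearIndependent_pair_iff_forall ha]
  rintro s rfl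
  have := (hg.pos a ha).ne'
  simp [this] at hab
  simp [hab] at hb

/-- Subtracting multiples of a and b makes w normal; the result is g-orthogonal to a and b, as w
already was, so the multiples vanish. -/
theorem mem_normalSpace_of_orthogonal (h : IsConformalBivectorForm R) (hg : IsInnerProduct g)
    (hf : IsConformalFactor R (fun x => g x x)) {a b w : W} (ha : a ≠ 0) (hb : b ≠ 0)
    (hab : g a b = 0) (haw : g a w = 0) (hbw : g b w = 0) : w ∈ normalSpace R a b := by
  have hli := linearIndependent_of_orthogonal hg ha hb hab
  have hba : g b a = 0 := by rw [hg.symm, hab]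
  have p1 := (h.pos a b hli).ne'
  have p2 := (h.pos b a (linearIndependent_pair_symm hli)).ne'
  set α := R b a b w / R b a b a with hα
  set β := R a b a w / R a b a b with hβ
  have hu : w - α • a - β • b ∈ normalSpace R a b := by
    rw [mem_normalSpace]
    constructor
    · simp [h.self', hβ, p1]
    · simp [h.self', hα, p2]
  have hu' : w - α • a - β • b ∈ normalSpace R b a := mem_normalSpace.mpr (mem_normalSpace.mp hu).symm
  have e1 := h.metric_eq_zero_of_mem_normalSpace hg hf hli hab hu
  have e2 := h.metric_eq_zero_of_mem_normalSpace hg hf (linearIndependent_pair_symm hli) hba hu'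
  simp [haw, hbw, hab, hba, (hg.pos a ha).ne', (hg.pos b hb).ne'] at e1 e2
  rw [e1, e2] at hu
  simpa using hu

theorem section_mul_of_orthogonal (h : IsConformalBivectorForm R) (hg : IsInnerProduct g)
    (hf : IsConformalFactor R (fun x => g x x)) {a b w : W} (ha : a ≠ 0) (hb : b ≠ 0) (hw : w ≠ 0)
    (hab : g a b = 0) (haw : g a w = 0) (hbw : g b w = 0) :
    R a w a w / (g a a * g w w) = R b w b w / (g b b * g w w) := by
  have := hf.ratio a b (linearIndependent_of_orthogonal hg ha hb hab) w
    (h.mem_normalSpace_of_orthogonal hg hf ha hb hab haw hbw) w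
  have p1 := (hg.pos a ha).ne'
  have p2 := (hg.pos b hb).ne'
  have p3 := (hg.pos w hw).ne'
  field_simp
  linarith

/-- The pair (a,w) is moved to (c,d) through (e,w), (k,w-free partner e) and (d,e), replacing one
vector at a time by one orthogonal to both; e and k exist by dimension. -/
theorem section_const (h : IsConformalBivectorForm R) (hW : Module.finrank ℝ W = 8)
    (hg : IsInnerProduct g) (hf : IsConformalFactor R (fun x => g x x)) {a w c d : W}
    (ha : a ≠ 0) (hw : w ≠ 0) (hc : c ≠ 0) (hd : d ≠ 0) (haw : g a w = 0) (hcd : g c d = 0) :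
    R a w a w / (g a a * g w w) = R c d c d / (g c c * g d d) := by
  have sy : ∀ x y, R x y x y / (g x x * g y y) = R y x y x / (g y y * g x x) := by
    intro x y
    rw [h.section_symm, mul_comm]
  obtain ⟨e, he, ze⟩ := exists_ne_zero_forall_eq_zero (by omega) ![g a, g w, g c, g d]
  have ea : g a e = 0 := ze 0
  have ew : g w e = 0 := ze 1
  have ec : g c e = 0 := ze 2
  have ed : g d e = 0 := ze 3
  obtain ⟨k, hk, zk⟩ := exists_ne_zero_forall_eq_zero (by omega) ![g w, g e, g d]
  have kw : g w k = 0 := zk 0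
  have ke : g e k = 0 := zk 1
  have kd : g d k = 0 := zk 2
  have S := fun x y => hg.symm x y
  rw [h.section_mul_of_orthogonal hg hf ha he hw ea haw (by rw [S, ew]), sy,
    h.section_mul_of_orthogonal hg hf hw hk he kw ew (by rw [S, ke]),
    h.section_mul_of_orthogonal hg hf hk hd he (by rw [S, kd]) (by rw [S, ke]) ed, sy,
    h.section_mul_of_orthogonal hg hf he hc hd (by rw [S, ec]) (by rw [S, ed]) hcd]

end Metric

/-- A positive form on bivectors satisfying condition (C) is the one induced by an inner product. -/
theorem exists_innerProduct (h : IsConformalBivectorForm R) (hW : Module.finrank ℝ W = 8) :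
    ∃ g : LinearMap.BilinForm ℝ W, IsInnerProduct g ∧
      ∀ u v, R u v u v = g u u * g v v - g u v ^ 2 := by
  obtain ⟨f, hf⟩ := h.exists_isConformalFactor hW
  obtain ⟨g, gs, gf⟩ := hf.exists_bilinForm h hW
  obtain rfl : f = fun x => g x x := (funext gf).symm
  have hg : IsInnerProduct g := ⟨gs, hf.pos⟩
  obtain ⟨a, ha, -⟩ := exists_ne_zero_forall_eq_zero (W := W) (k := 0) (by omega) ![]
  obtain ⟨b, hb, zb⟩ := exists_ne_zero_forall_eq_zero (by omega) ![g a]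
  have hab : g a b = 0 := zb 0
  set κ := R a b a b / (g a a * g b b) with hκ
  have κpos : 0 < κ := div_pos (h.pos a b (linearIndependent_of_orthogonal hg ha hb hab))
    (mul_pos (hg.pos a ha) (hg.pos b hb))
  have main : ∀ u v, R u v u v = κ * (g u u * g v v - g u v ^ 2) := by
    intro u v
    by_cases hu : u = 0
    · simp [hu]
    have pu := (hg.pos u hu).ne'
    set v' := v - (g u v / g u u) • u with hv'
    have o : g u v' = 0 := by simp [hv', pu]
    have e1 : R u v u v = R u v' u v' := by
      have : v = v' + (g u v / g u u) • u := by simp [hv']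
      conv_lhs => rw [this]
      simp [h.self, h.self']
    have e2 : g u u * g v v - g u v ^ 2 = g u u * g v' v' := by
      simp only [hv', map_sub, _root_.map_smul, LinearMap.sub_apply, LinearMap.smul_apply, smul_eq_mul]
      rw [gs v u]
      field_simp
      ring
    rw [e1, e2]
    by_cases hv0 : v' = 0
    · simp [hv0]
    have pv := (hg.pos v' hv0).ne'
    rw [hκ, h.section_const hW hg hf ha hb hu hv0 hab o]
    field_simp
  -- The Gram determinant is quadratic in g, so √κ absorbs κ.
  refine ⟨Real.sqrt κ • g, ⟨fun u v => by simp [gs u v], fun u hu => ?_⟩, fun u v => ?_⟩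
  · have := hg.pos u hu
    simp only [LinearMap.smul_apply, smul_eq_mul]
    positivity
  · rw [main]
    simp only [LinearMap.smul_apply, smul_eq_mul]
    nth_rewrite 1 [← Real.mul_self_sqrt κpos.le]
    ring

end IsConformalBivectorForm
end

/-! ### Maxima on unit vectors and representation of functionals -/

section

variable {W : Type*} [AddCommGroup W] [Module ℝ W]

/-- The skew-symmetry of a 4-linear map. -/
structure IsSkew (F : W →ₗ[ℝ] W →ₗ[ℝ] W →ₗ[ℝ] W →ₗ[ℝ] ℝ) : Prop where
  swap₁₂ : ∀ u v w x, F v u w x = -F u v w x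
  swap₂₃ : ∀ u v w x, F u w v x = -F u v w x
  swap₃₄ : ∀ u v w x, F u v x w = -F u v w x

theorem isSkew_curried (Φ : W [⋀^Fin 4]→ₗ[ℝ] ℝ) : IsSkew (curried Φ) :=
  ⟨curried_swap₁₂ Φ, curried_swap₂₃ Φ, curried_swap₃₄ Φ⟩

variable {g : LinearMap.BilinForm ℝ W} {F : W →ₗ[ℝ] W →ₗ[ℝ] W →ₗ[ℝ] W →ₗ[ℝ] ℝ}

theorem IsInnerProduct.exists_max (hg : IsInnerProduct g) (hW : 0 < Module.finrank ℝ W)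
    (F : W →ₗ[ℝ] W →ₗ[ℝ] W →ₗ[ℝ] W →ₗ[ℝ] ℝ) :
    ∃ a b c d : W, g a a = 1 ∧ g b b = 1 ∧ g c c = 1 ∧ g d d = 1 ∧
      ∀ a' b' c' d', g a' a' = 1 → g b' b' = 1 → g c' c' = 1 → g d' d' = 1 →
        F a' b' c' d' ≤ F a b c d := by
  have : FiniteDimensional ℝ W := FiniteDimensional.of_finrank_pos hW
  have : Nontrivial W := Module.nontrivial_of_finrank_pos hW
  let core : InnerProductSpace.Core ℝ W :=
    { inner := fun x y => g x y
      conj_inner_symm := fun x y => by simp [hg.symm x y]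
      re_inner_nonneg := fun x => by
        by_cases hx : x = 0
        · simp [hx]
        · simpa using (hg.pos x hx).le
      add_left := fun x y z => by simp
      smul_left := fun x y r => by simp
      definite := fun x hx => by
        by_contra h
        exact (hg.pos x h).ne' hx }
  let _ : NormedAddCommGroup W := core.toNormedAddCommGroup
  let _ : InnerProductSpace ℝ W := InnerProductSpace.ofCore core.toCore
  have hn : ∀ x : W, g x x = ‖x‖ ^ 2 := fun x => (real_inner_self_eq_norm_sq x)
  have h1 : ∀ x : W, g x x = 1 ↔ x ∈ Metric.sphere (0 : W) 1 := by
    intro x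
    rw [hn, mem_sphere_zero_iff_norm, pow_eq_one_iff_of_nonneg (norm_nonneg x) two_ne_zero]
  have : ProperSpace W := FiniteDimensional.proper ℝ W
  set S := Metric.sphere (0 : W) 1
  have hS : IsCompact S := isCompact_sphere 0 1
  have hSn : S.Nonempty := NormedSpace.sphere_nonempty.mpr zero_le_one
  let e := Module.finBasis ℝ W
  have hF : ∀ a b c d, F a b c d = ∑ i, e.coord i a * ∑ j, e.coord j b *
      ∑ k, e.coord k c * ∑ l, e.coord l d * F (e i) (e j) (e k) (e l) := by
    intro a b c d
    have exp₁ : ∀ (l : W →ₗ[ℝ] ℝ) (x : W), l x = ∑ i, e.coord i x * l (e i) := by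
      intro l x
      conv_lhs => rw [← e.sum_repr x]
      rw [map_sum]
      simp only [map_smul, smul_eq_mul, Module.Basis.coord_apply]
    refine (exp₁ (((F.flip b).flip c).flip d) a).trans ?_
    refine Finset.sum_congr rfl fun i _ => congrArg _ ?_
    refine (exp₁ (((F (e i)).flip c).flip d) b).trans ?_
    refine Finset.sum_congr rfl fun j _ => congrArg _ ?_
    refine (exp₁ ((F (e i) (e j)).flip d) c).trans ?_
    refine Finset.sum_congr rfl fun k _ => congrArg _ ?_
    exact exp₁ (F (e i) (e j) (e k)) d
  have hc : ∀ i, Continuous (e.coord i) := fun i => LinearMap.continuous_of_finiteDimensional _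
  have hcont : Continuous fun p : W × W × W × W => F p.1 p.2.1 p.2.2.1 p.2.2.2 := by
    have h : (fun p : W × W × W × W => F p.1 p.2.1 p.2.2.1 p.2.2.2) = _ :=
      funext fun p => hF p.1 p.2.1 p.2.2.1 p.2.2.2
    rw [h]
    fun_prop
  obtain ⟨⟨a, b, c, d⟩, hm, hmax⟩ := (hS.prod (hS.prod (hS.prod hS))).exists_isMaxOn
    (hSn.prod (hSn.prod (hSn.prod hSn))) hcont.continuousOn
  refine ⟨a, b, c, d, (h1 _).mpr hm.1, (h1 _).mpr hm.2.1, (h1 _).mpr hm.2.2.1,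
    (h1 _).mpr hm.2.2.2, fun a' b' c' d' ha hb hc hd => ?_⟩
  exact hmax (show (a', b', c', d') ∈ _ from
    ⟨(h1 _).mp ha, (h1 _).mp hb, (h1 _).mp hc, (h1 _).mp hd⟩)

theorem IsInnerProduct.eq_zero (hg : IsInnerProduct g) {x : W} (h : g x x ≤ 0) : x = 0 := by
  by_contra hx
  exact absurd (hg.pos x hx) (not_lt.mpr h)

theorem IsInnerProduct.exists_smul_unit (hg : IsInnerProduct g) {z : W} (hz : z ≠ 0) :
    ∃ (y : W) (s : ℝ), g y y = 1 ∧ z = s • y ∧ s ≠ 0 := by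
  have hp := hg.pos z hz
  have hs := Real.sqrt_pos.mpr hp
  have hs2 := Real.mul_self_sqrt hp.le
  refine ⟨(Real.sqrt (g z z))⁻¹ • z, Real.sqrt (g z z), ?_, ?_, hs.ne'⟩
  · simp only [map_smul, LinearMap.smul_apply, smul_eq_mul]
    field_simp
    rw [sq, hs2]
  · rw [smul_smul, mul_inv_cancel₀ hs.ne', one_smul]

theorem IsInnerProduct.exists_unit_orthogonal (hg : IsInnerProduct g) {k : ℕ}
    (hk : k < Module.finrank ℝ W) (y : Fin k → W) : ∃ x, g x x = 1 ∧ ∀ i, g (y i) x = 0 := by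
  obtain ⟨z, hz, h⟩ := exists_ne_zero_forall_eq_zero hk fun i => g (y i)
  obtain ⟨x, s, hx, rfl, hs⟩ := hg.exists_smul_unit hz
  exact ⟨x, hx, fun i => by simpa [hs] using h i⟩

theorem IsInnerProduct.exists_rep (hg : IsInnerProduct g) [FiniteDimensional ℝ W] (l : W →ₗ[ℝ] ℝ) :
    ∃ z, ∀ x, l x = g z x := by
  have h : g.Nondegenerate := by
    refine ⟨fun x hx => hg.eq_zero (hx x).le, fun x hx => hg.eq_zero (hx x).le⟩
  refine ⟨(LinearMap.BilinForm.toDual g h).symm l, fun x => ?_⟩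
  rw [LinearMap.BilinForm.apply_toDual_symm_apply]

theorem IsInnerProduct.exists_unit_rep (hg : IsInnerProduct g) {k : ℕ}
    (hk : k < Module.finrank ℝ W) (y : Fin k → W) (l : W →ₗ[ℝ] ℝ) (hl : ∀ i, l (y i) = 0) :
    ∃ x s, g x x = 1 ∧ (∀ i, g (y i) x = 0) ∧ ∀ z, l z = s * g x z := by
  have : FiniteDimensional ℝ W := FiniteDimensional.of_finrank_pos (by omega)
  obtain ⟨z, hz⟩ := hg.exists_rep l
  by_cases h0 : z = 0
  · obtain ⟨x, hx, h⟩ := hg.exists_unit_orthogonal hk y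
    exact ⟨x, 0, hx, h, fun w => by simp [hz, h0]⟩
  · obtain ⟨x, s, hx, rfl, hs⟩ := hg.exists_smul_unit h0
    refine ⟨x, s, hx, fun i => ?_, fun w => by simp [hz]⟩
    have := hl i
    rw [hz] at this
    rw [hg.symm]
    simpa [hs] using this

/-- First-order condition at a maximum, via Cauchy–Schwarz: if l = s g(y,·) with y a unit vector,
then |s y − l(e) e|² = s² − l(e)² ≤ 0. -/
theorem IsInnerProduct.eq_of_forall_le (hg : IsInnerProduct g) (hW : 0 < Module.finrank ℝ W)
    (l : W →ₗ[ℝ] ℝ) {e : W} (he : g e e = 1) (hmax : ∀ x, g x x = 1 → l x ≤ l e) (x : W) :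
    l x = l e * g e x := by
  obtain ⟨y, s, hy, -, hl⟩ := hg.exists_unit_rep hW ![] l (by simp)
  have h1 := hmax y hy
  have h2 := hmax (-y) (by simp [hy])
  have h3 : l y = s := by rw [hl, hy, mul_one]
  rw [map_neg, h3] at h2
  rw [h3] at h1
  have h4 := hl e
  have h5 : s • y - l e • e = 0 := by
    apply hg.eq_zero
    simp only [map_sub, map_smul, LinearMap.sub_apply, LinearMap.smul_apply, smul_eq_mul, he, hy,
      hg.symm e y]
    nlinarith
  have h6 : g (s • y) x = g (l e • e) x := by rw [eq_of_sub_eq_zero h5]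
  simpa [hl] using h6

end

/-! ### Algebra of skew 4×4 matrices -/

section

/-- The matrix of a 2-form on a 4-dimensional space. -/
def skewMatrix (p q r s t u : ℝ) : Matrix (Fin 4) (Fin 4) ℝ :=
  !![0, p, q, r; -p, 0, s, t; -q, -s, 0, u; -r, -t, -u, 0]

/-- The second factor on each side is a Hodge dual. This polarises A·(*A) = −Pf(A)·1, with `h`
saying that the polarised Pfaffian vanishes. -/
theorem skewMatrix_mul_dual (p q r s t u p' q' r' s' t' u' : ℝ)
    (h : p * u' - q * t' + r * s' + s * r' - t * q' + u * p' = 0) :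
    skewMatrix p q r s t u * skewMatrix u' (-t') s' r' (-q') p' =
      -(skewMatrix p' q' r' s' t' u' * skewMatrix u (-t) s r (-q) p) := by
  ext i j
  fin_cases i <;> fin_cases j <;> simp [skewMatrix, Matrix.mul_apply, Fin.sum_univ_four] <;>
    first | ring1 | linear_combination h | linear_combination -h

theorem skewMatrix_transpose (p q r s t u : ℝ) :
    (skewMatrix p q r s t u).transpose = -skewMatrix p q r s t u := by
  ext i j
  fin_cases i <;> fin_cases j <;> simp [skewMatrix]

theorem det_skewMatrix (p q r s t u : ℝ) :
    (skewMatrix p q r s t u).det = (p * u - q * t + r * s) ^ 2 := by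
  simp [skewMatrix, Matrix.det_succ_row_zero, Fin.sum_univ_succ, Fin.succAbove]
  ring

/-- With Bᵢ the dual of Aᵢ, the pairwise orthogonality relations make N = A₂B₁A₃ symmetric, and
`hdet` gives its quadratic form. So N = −ε·1, and determinants yield P⁶ = ε⁴ = 1. -/
theorem pfaffian_pow_six_eq_one {p₁ q₁ r₁ s₁ t₁ u₁ p₂ q₂ r₂ s₂ t₂ u₂ p₃ q₃ r₃ s₃ t₃ u₃ P ε : ℝ}
    (h₁ : p₁ * u₁ - q₁ * t₁ + r₁ * s₁ = P) (h₂ : p₂ * u₂ - q₂ * t₂ + r₂ * s₂ = P)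
    (h₃ : p₃ * u₃ - q₃ * t₃ + r₃ * s₃ = P)
    (h₁₂ : p₁ * u₂ - q₁ * t₂ + r₁ * s₂ + s₁ * r₂ - t₁ * q₂ + u₁ * p₂ = 0)
    (h₁₃ : p₁ * u₃ - q₁ * t₃ + r₁ * s₃ + s₁ * r₃ - t₁ * q₃ + u₁ * p₃ = 0)
    (h₂₃ : p₂ * u₃ - q₂ * t₃ + r₂ * s₃ + s₂ * r₃ - t₂ * q₃ + u₂ * p₃ = 0)
    (hε : ε ^ 2 = 1)
    (hdet : ∀ x y z : ℝ,
      (p₁ - y * s₁ - z * t₁) * ((q₂ + x * s₂ - z * u₂) * (r₃ + x * t₃ + y * u₃) -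
          (r₂ + x * t₂ + y * u₂) * (q₃ + x * s₃ - z * u₃)) -
        (q₁ + x * s₁ - z * u₁) * ((p₂ - y * s₂ - z * t₂) * (r₃ + x * t₃ + y * u₃) -
          (r₂ + x * t₂ + y * u₂) * (p₃ - y * s₃ - z * t₃)) +
        (r₁ + x * t₁ + y * u₁) * ((p₂ - y * s₂ - z * t₂) * (q₃ + x * s₃ - z * u₃) -
          (q₂ + x * s₂ - z * u₂) * (p₃ - y * s₃ - z * t₃)) = ε * (1 + x ^ 2 + y ^ 2 + z ^ 2)) :
    P ^ 6 = 1 := by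
  set A₁ := skewMatrix p₁ q₁ r₁ s₁ t₁ u₁ with hA₁
  set A₂ := skewMatrix p₂ q₂ r₂ s₂ t₂ u₂ with hA₂
  set A₃ := skewMatrix p₃ q₃ r₃ s₃ t₃ u₃ with hA₃
  set B₁ := skewMatrix u₁ (-t₁) s₁ r₁ (-q₁) p₁ with hB₁
  set B₂ := skewMatrix u₂ (-t₂) s₂ r₂ (-q₂) p₂ with hB₂
  set B₃ := skewMatrix u₃ (-t₃) s₃ r₃ (-q₃) p₃ with hB₃
  have c₂₁ : A₂ * B₁ = -(A₁ * B₂) :=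
    skewMatrix_mul_dual _ _ _ _ _ _ _ _ _ _ _ _ (by linear_combination h₁₂)
  have c₁₃ : A₁ * B₃ = -(A₃ * B₁) :=
    skewMatrix_mul_dual _ _ _ _ _ _ _ _ _ _ _ _ (by linear_combination h₁₃)
  have c₂₃ : B₂ * A₃ = -(B₃ * A₂) := by
    have := skewMatrix_mul_dual u₂ (-t₂) s₂ r₂ (-q₂) p₂ u₃ (-t₃) s₃ r₃ (-q₃) p₃
      (by linear_combination h₂₃)
    simpa only [neg_neg] using this
  set N := A₂ * B₁ * A₃ with hN
  have hsymm : N.transpose = N := by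
    rw [hN, Matrix.transpose_mul, Matrix.transpose_mul, hA₃, hB₁, hA₂]
    simp only [skewMatrix_transpose]
    rw [← hA₃, ← hB₁, ← hA₂]
    calc -A₃ * (-B₁ * -A₂) = -(A₃ * B₁) * A₂ := by simp [mul_assoc]
      _ = A₁ * (B₃ * A₂) := by rw [← c₁₃, mul_assoc]
      _ = -(A₁ * B₂) * A₃ := by rw [← neg_eq_iff_eq_neg.mpr c₂₃]; simp [mul_assoc]
      _ = A₂ * B₁ * A₃ := by rw [c₂₁]
  -- For ξ = (1,x,y,z), the 3×3 determinant formed from the last three entries of the rows ξᵀA₁,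
  -- ξᵀA₂, ξᵀA₃ is −ξᵀNξ.
  have hq : ∀ x y z : ℝ, N 0 0 + x ^ 2 * N 1 1 + y ^ 2 * N 2 2 + z ^ 2 * N 3 3 +
      x * (N 0 1 + N 1 0) + y * (N 0 2 + N 2 0) + z * (N 0 3 + N 3 0) +
      x * y * (N 1 2 + N 2 1) + x * z * (N 1 3 + N 3 1) + y * z * (N 2 3 + N 3 2) =
      -ε * (1 + x ^ 2 + y ^ 2 + z ^ 2) := by
    intro x y z
    have h := hdet x y z
    simp [hN, hA₂, hB₁, hA₃, skewMatrix]
    linear_combination -h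
  have hs : ∀ i j, N i j = N j i := fun i j => congrFun (congrFun hsymm j) i
  have hI : N = -ε • (1 : Matrix (Fin 4) (Fin 4) ℝ) := by
    have := hs 1 0
    have := hs 2 0
    have := hs 3 0
    have := hs 2 1
    have := hs 3 1
    have := hs 3 2
    have := hq 0 0 0
    have := hq 1 0 0
    have := hq (-1) 0 0
    have := hq 0 1 0
    have := hq 0 (-1) 0
    have := hq 0 0 1
    have := hq 0 0 (-1)
    have := hq 1 1 0
    have := hq 1 0 1
    have := hq 0 1 1
    ext i j
    fin_cases i <;> fin_cases j <;> simp <;> linarith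
  have hd := congrArg Matrix.det hI
  rw [hN, Matrix.det_mul, Matrix.det_mul, hA₂, hB₁, hA₃, det_skewMatrix, det_skewMatrix,
    det_skewMatrix, Matrix.det_smul, Matrix.det_one, Fintype.card_fin, h₂, h₃] at hd
  rw [show u₁ * p₁ - -t₁ * -q₁ + s₁ * r₁ = P by linear_combination h₁] at hd
  linear_combination hd + (ε ^ 2 + 1) * hε

end

/-! ### Critical frames and the maximal value -/

section

variable {W : Type*} [AddCommGroup W] [Module ℝ W]
variable {g : LinearMap.BilinForm ℝ W} {F : W →ₗ[ℝ] W →ₗ[ℝ] W →ₗ[ℝ] W →ₗ[ℝ] ℝ}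
  {D : W [⋀^Fin 8]→ₗ[ℝ] ℝ}

/-- The family `e` is orthonormal for `g`. -/
def IsOrthonormal (g : LinearMap.BilinForm ℝ W) {n : ℕ} (e : Fin n → W) : Prop :=
  ∀ i j, g (e i) (e j) = if i = j then 1 else 0

/-- The Pfaffian of the 2-form `F u v` on six vectors is the product of `|u ∧ v|²` and the volume
of the eight vectors. -/
def HasPfaffian (g : LinearMap.BilinForm ℝ W) (F : W →ₗ[ℝ] W →ₗ[ℝ] W →ₗ[ℝ] W →ₗ[ℝ] ℝ)
    (D : W [⋀^Fin 8]→ₗ[ℝ] ℝ) : Prop :=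
  ∀ u v x₁ x₂ x₃ x₄ x₅ x₆ : W, pfaffian₆ (fun s t => F u v s t) x₁ x₂ x₃ x₄ x₅ x₆ =
    (g u u * g v v - g u v ^ 2) * D ![u, v, x₁, x₂, x₃, x₄, x₅, x₆]

theorem map_add_slot (D : W [⋀^Fin 8]→ₗ[ℝ] ℝ) (u v v' x₁ x₂ x₃ x₄ x₅ x₆ : W) :
    D ![u, v + v', x₁, x₂, x₃, x₄, x₅, x₆] =
      D ![u, v, x₁, x₂, x₃, x₄, x₅, x₆] + D ![u, v', x₁, x₂, x₃, x₄, x₅, x₆] :=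
  (D.curryLeft u).map_vecCons_add ![x₁, x₂, x₃, x₄, x₅, x₆] v v'

theorem map_smul_slot (D : W [⋀^Fin 8]→ₗ[ℝ] ℝ) (c : ℝ) (u v x₁ x₂ x₃ x₄ x₅ x₆ : W) :
    D ![u, c • v, x₁, x₂, x₃, x₄, x₅, x₆] = c * D ![u, v, x₁, x₂, x₃, x₄, x₅, x₆] :=
  (D.curryLeft u).map_vecCons_smul ![x₁, x₂, x₃, x₄, x₅, x₆] c v

namespace IsSkew

theorem self₃₄ (hF : IsSkew F) (u v w : W) : F u v w w = 0 := by
  have := hF.swap₃₄ u v w w; linarith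

theorem self₂₃ (hF : IsSkew F) (u v w : W) : F u v v w = 0 := by
  have := hF.swap₂₃ u v v w; linarith

theorem self₂₄ (hF : IsSkew F) (u v w : W) : F u v w v = 0 := by
  rw [hF.swap₃₄, hF.self₂₃, neg_zero]

end IsSkew

/-- An orthonormal frame at whose first four vectors the value of `F` is critical. -/
structure IsCriticalFrame (g : LinearMap.BilinForm ℝ W)
    (F : W →ₗ[ℝ] W →ₗ[ℝ] W →ₗ[ℝ] W →ₗ[ℝ] ℝ) (D : W [⋀^Fin 8]→ₗ[ℝ] ℝ) (e : Fin 8 → W)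
    (c δ : ℝ) : Prop where
  orthonormal : IsOrthonormal g e
  volume : D e = δ
  value : F (e 0) (e 1) (e 2) (e 3) = c
  zero₁₂ : ∀ k, 4 ≤ k → F (e 0) (e 1) (e 2) (e k) = 0
  zero₁₃ : ∀ k, 4 ≤ k → F (e 0) (e 1) (e 3) (e k) = 0
  zero₂₃ : ∀ k, 4 ≤ k → F (e 0) (e 2) (e 3) (e k) = 0

namespace IsCriticalFrame

variable {e : Fin 8 → W} {c δ : ℝ}

theorem volume' (h : IsCriticalFrame g F D e c δ) :
    D ![e 0, e 1, e 2, e 3, e 4, e 5, e 6, e 7] = δ := by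
  rw [← h.volume]
  congr 1
  funext i; fin_cases i <;> rfl

/-- This symmetry and the next allow each identity to be proved for one index only. A 3-cycle
preserves the volume; the 4-cycle below reverses it. -/
theorem rotate₁₂₃ (h : IsCriticalFrame g F D e c δ) (hF : IsSkew F) :
    IsCriticalFrame g F D ![e 0, e 2, e 3, e 1, e 4, e 5, e 6, e 7] c δ := by
  have he : (![e 0, e 2, e 3, e 1, e 4, e 5, e 6, e 7] : Fin 8 → W) =
      e ∘ (Equiv.swap (1 : Fin 8) 2 * Equiv.swap (2 : Fin 8) 3 : Equiv.Perm (Fin 8)) := by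
    funext i; fin_cases i <;> rfl
  have hk : ∀ k : Fin 8, 4 ≤ k → (![e 0, e 2, e 3, e 1, e 4, e 5, e 6, e 7] : Fin 8 → W) k = e k := by
    intro k hk
    fin_cases k <;> first | rfl | exact absurd hk (by decide)
  refine ⟨?_, ?_, ?_, fun k h4 => ?_, fun k h4 => ?_, fun k h4 => ?_⟩
  · intro i j
    rw [he, Function.comp, Function.comp, h.orthonormal]
    simp only [EmbeddingLike.apply_eq_iff_eq]
  · rw [he, D.map_perm, map_mul, Equiv.Perm.sign_swap (by decide), Equiv.Perm.sign_swap (by decide),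
      h.volume]
    simp
  · change F (e 0) (e 2) (e 3) (e 1) = c
    rw [hF.swap₃₄, hF.swap₂₃, neg_neg, h.value]
  · rw [hk k h4]
    exact h.zero₂₃ k h4
  · rw [hk k h4]
    exact (hF.swap₂₃ (e 0) (e 1) (e 2) (e k)).trans (by rw [h.zero₁₂ k h4, neg_zero])
  · rw [hk k h4]
    exact (hF.swap₂₃ (e 0) (e 1) (e 3) (e k)).trans (by rw [h.zero₁₃ k h4, neg_zero])

theorem rotate₄₅₆₇ (h : IsCriticalFrame g F D e c δ) :
    IsCriticalFrame g F D ![e 0, e 1, e 2, e 3, e 5, e 6, e 7, e 4] c (-δ) := by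
  set σ : Equiv.Perm (Fin 8) := Equiv.swap (4 : Fin 8) 5 * Equiv.swap (5 : Fin 8) 6 *
    Equiv.swap (6 : Fin 8) 7 with hσ
  have he : (![e 0, e 1, e 2, e 3, e 5, e 6, e 7, e 4] : Fin 8 → W) = e ∘ σ := by
    funext i; fin_cases i <;> rfl
  have hk : ∀ k : Fin 8, 4 ≤ k → 4 ≤ σ k := by rw [hσ]; decide
  refine ⟨?_, ?_, h.value, fun k h4 => ?_, fun k h4 => ?_, fun k h4 => ?_⟩
  · intro i j
    rw [he, Function.comp, Function.comp, h.orthonormal]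
    simp only [EmbeddingLike.apply_eq_iff_eq]
  · rw [he, D.map_perm, hσ, map_mul, map_mul, Equiv.Perm.sign_swap (by decide),
      Equiv.Perm.sign_swap (by decide), Equiv.Perm.sign_swap (by decide), h.volume]
    simp
  · rw [he]
    exact h.zero₁₂ _ (hk k h4)
  · rw [he]
    exact h.zero₁₃ _ (hk k h4)
  · rw [he]
    exact h.zero₂₃ _ (hk k h4)

/-- Criticality leaves e₃ as the only partner of e₂ under F(e₀,e₁,·,·), so the Pfaffian splits off
the factor c. -/
theorem pfaffian₁ (h : IsCriticalFrame g F D e c δ) (H : HasPfaffian g F D) :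
    c * (F (e 0) (e 1) (e 4) (e 5) * F (e 0) (e 1) (e 6) (e 7)
      - F (e 0) (e 1) (e 4) (e 6) * F (e 0) (e 1) (e 5) (e 7)
      + F (e 0) (e 1) (e 4) (e 7) * F (e 0) (e 1) (e 5) (e 6)) = δ := by
  have := H (e 0) (e 1) (e 2) (e 3) (e 4) (e 5) (e 6) (e 7)
  rw [h.volume', h.orthonormal, h.orthonormal, h.orthonormal] at this
  simp only [pfaffian₆, h.value, h.zero₁₂ 4 (by decide), h.zero₁₂ 5 (by decide),
    h.zero₁₂ 6 (by decide), h.zero₁₂ 7 (by decide)] at this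
  norm_num at this
  linear_combination this

theorem pfaffian₂ (h : IsCriticalFrame g F D e c δ) (hF : IsSkew F) (H : HasPfaffian g F D) :
    c * (F (e 0) (e 2) (e 4) (e 5) * F (e 0) (e 2) (e 6) (e 7)
      - F (e 0) (e 2) (e 4) (e 6) * F (e 0) (e 2) (e 5) (e 7)
      + F (e 0) (e 2) (e 4) (e 7) * F (e 0) (e 2) (e 5) (e 6)) = δ :=
  (h.rotate₁₂₃ hF).pfaffian₁ H

/-- Replacing e₁ by e₁ + e₂ keeps the volume and doubles |e₀∧e₁|², which is exactly the sum of the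
two pure terms. -/
theorem polar₁₂ (h : IsCriticalFrame g F D e c δ) (hF : IsSkew F) (H : HasPfaffian g F D) :
    c * (F (e 0) (e 1) (e 4) (e 5) * F (e 0) (e 2) (e 6) (e 7)
      - F (e 0) (e 1) (e 4) (e 6) * F (e 0) (e 2) (e 5) (e 7)
      + F (e 0) (e 1) (e 4) (e 7) * F (e 0) (e 2) (e 5) (e 6)
      + F (e 0) (e 1) (e 5) (e 6) * F (e 0) (e 2) (e 4) (e 7)
      - F (e 0) (e 1) (e 5) (e 7) * F (e 0) (e 2) (e 4) (e 6)
      + F (e 0) (e 1) (e 6) (e 7) * F (e 0) (e 2) (e 4) (e 5)) = 0 := by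
  have := H (e 0) (e 1 + e 2) (e 2) (e 3) (e 4) (e 5) (e 6) (e 7)
  rw [map_add_slot, h.volume', D.map_eq_zero_of_eq _ (i := 1) (j := 2) rfl (by decide)] at this
  simp only [pfaffian₆, map_add, LinearMap.add_apply, h.value, h.zero₁₂ 4 (by decide),
    h.zero₁₂ 5 (by decide), h.zero₁₂ 6 (by decide), h.zero₁₂ 7 (by decide), hF.self₂₃,
    h.orthonormal _ _, Fin.reduceEq, reduceIte] at this
  norm_num at this
  have h1 := h.pfaffian₁ H
  have h2 := h.pfaffian₂ hF H
  linear_combination this - h1 - h2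

/-- Replacing e₁ by e₁ + s e₄ multiplies the right side by 1 + s², which has no linear term. The
values s = ±1 isolate the linear coefficient, there being no cubic one. -/
theorem dual₄ (h : IsCriticalFrame g F D e c δ) (hF : IsSkew F) (H : HasPfaffian g F D) :
    c * (F (e 0) (e 1) (e 4) (e 5) * F (e 0) (e 4) (e 6) (e 7)
      - F (e 0) (e 1) (e 4) (e 6) * F (e 0) (e 4) (e 5) (e 7)
      + F (e 0) (e 1) (e 4) (e 7) * F (e 0) (e 4) (e 5) (e 6)) = 0 := by
  have main : ∀ s : ℝ, _ := fun s => H (e 0) (e 1 + s • e 4) (e 2) (e 3) (e 4) (e 5) (e 6) (e 7)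
  have z23 : F (e 0) (e 4) (e 2) (e 3) = 0 := by
    rw [hF.swap₂₃, hF.swap₃₄, h.zero₂₃ 4 (by decide)]; simp
  have z24 : F (e 0) (e 4) (e 2) (e 4) = 0 := hF.self₂₄ _ _ _
  have z34 : F (e 0) (e 4) (e 3) (e 4) = 0 := hF.self₂₄ _ _ _
  have vol : ∀ s : ℝ, D ![e 0, e 1 + s • e 4, e 2, e 3, e 4, e 5, e 6, e 7] = δ := by
    intro s
    rw [map_add_slot, map_smul_slot, h.volume',
      D.map_eq_zero_of_eq _ (i := 1) (j := 4) rfl (by decide)]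
    simp
  simp only [vol, pfaffian₆, map_add, map_smul, LinearMap.add_apply, LinearMap.smul_apply,
    smul_eq_mul, h.value, h.zero₁₂ 4 (by decide),
    h.zero₁₂ 5 (by decide), h.zero₁₂ 6 (by decide), h.zero₁₂ 7 (by decide), h.zero₁₃ 4 (by decide),
    h.zero₁₃ 5 (by decide), h.zero₁₃ 6 (by decide), h.zero₁₃ 7 (by decide), hF.self₂₃,
    z23, z24, z34, h.orthonormal _ _, Fin.reduceEq, reduceIte] at main
  have m1 := main 1
  have m2 := main (-1)
  norm_num at m1 m2
  linear_combination (m1 - m2) / 2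

/-- The four rotated relations form a linear system with the skew matrix of F(e₀,e₁,·,·) on e₄,…,e₇;
multiplying by its dual leaves c times its Pfaffian, that is δ ≠ 0. -/
theorem dual (h : IsCriticalFrame g F D e c δ) (hF : IsSkew F) (H : HasPfaffian g F D)
    (hδ : δ ≠ 0) :
    F (e 0) (e 4) (e 5) (e 6) = 0 ∧ F (e 0) (e 4) (e 5) (e 7) = 0 ∧
      F (e 0) (e 4) (e 6) (e 7) = 0 ∧ F (e 0) (e 5) (e 6) (e 7) = 0 := by
  have q4 := h.dual₄ hF H
  have q5 := h.rotate₄₅₆₇.dual₄ hF H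
  have q6 := h.rotate₄₅₆₇.rotate₄₅₆₇.dual₄ hF H
  have q7 := h.rotate₄₅₆₇.rotate₄₅₆₇.rotate₄₅₆₇.dual₄ hF H
  have P := h.pfaffian₁ H
  simp only [Matrix.cons_val] at q5 q6 q7
  have sw : ∀ i j, F (e 0) (e 1) (e j) (e i) = -F (e 0) (e 1) (e i) (e j) :=
    fun i j => hF.swap₃₄ _ _ _ _
  have cy : ∀ i j k, F (e 0) (e j) (e k) (e i) = F (e 0) (e i) (e j) (e k) := fun i j k => by
    rw [hF.swap₃₄, hF.swap₂₃, neg_neg]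
  have sk : ∀ i j k, F (e 0) (e i) (e k) (e j) = -F (e 0) (e i) (e j) (e k) :=
    fun i j k => hF.swap₃₄ _ _ _ _
  rw [sw 4 5, cy 4 5 7, cy 4 5 6] at q5
  rw [sw 4 6, sw 5 6, ← cy 6 4 5, cy 5 6 7, cy 4 6 7] at q6
  rw [sw 4 7, sw 5 7, sw 6 7, ← cy 7 5 6, ← cy 7 4 6, ← cy 7 4 5] at q7
  set p := F (e 0) (e 1) (e 4) (e 5)
  set q := F (e 0) (e 1) (e 4) (e 6)
  set r := F (e 0) (e 1) (e 4) (e 7)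
  set s := F (e 0) (e 1) (e 5) (e 6)
  set t := F (e 0) (e 1) (e 5) (e 7)
  set u := F (e 0) (e 1) (e 6) (e 7)
  refine ⟨?_, ?_, ?_, ?_⟩ <;> refine (mul_eq_zero.mp (?_ : δ * _ = 0)).resolve_left hδ <;> rw [← P]
  · linear_combination s * q4 + q * q5 + p * q6
  · linear_combination t * q4 + r * q5 - p * q7
  · linear_combination u * q4 - r * q6 - q * q7
  · linear_combination -u * q5 - t * q6 - s * q7

/-- For v = e₄ + x e₅ + y e₆ + z e₇ the form F(e₀,v,·,·) vanishes on the span of e₁,e₂,e₃ and on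
that of e₅,e₆,e₇. Its Pfaffian is therefore, up to sign, the determinant of the off-diagonal 3×3
block. -/
theorem det_rows (h : IsCriticalFrame g F D e c δ) (hF : IsSkew F) (H : HasPfaffian g F D)
    (hδ : δ ≠ 0) {p₁ q₁ r₁ s₁ t₁ u₁ p₂ q₂ r₂ s₂ t₂ u₂ p₃ q₃ r₃ s₃ t₃ u₃ : ℝ}
    (hp₁ : F (e 0) (e 1) (e 4) (e 5) = p₁) (hq₁ : F (e 0) (e 1) (e 4) (e 6) = q₁)
    (hr₁ : F (e 0) (e 1) (e 4) (e 7) = r₁) (hs₁ : F (e 0) (e 1) (e 5) (e 6) = s₁)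
    (ht₁ : F (e 0) (e 1) (e 5) (e 7) = t₁) (hu₁ : F (e 0) (e 1) (e 6) (e 7) = u₁)
    (hp₂ : F (e 0) (e 2) (e 4) (e 5) = p₂) (hq₂ : F (e 0) (e 2) (e 4) (e 6) = q₂)
    (hr₂ : F (e 0) (e 2) (e 4) (e 7) = r₂) (hs₂ : F (e 0) (e 2) (e 5) (e 6) = s₂)
    (ht₂ : F (e 0) (e 2) (e 5) (e 7) = t₂) (hu₂ : F (e 0) (e 2) (e 6) (e 7) = u₂)
    (hp₃ : F (e 0) (e 3) (e 4) (e 5) = p₃) (hq₃ : F (e 0) (e 3) (e 4) (e 6) = q₃)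
    (hr₃ : F (e 0) (e 3) (e 4) (e 7) = r₃) (hs₃ : F (e 0) (e 3) (e 5) (e 6) = s₃)
    (ht₃ : F (e 0) (e 3) (e 5) (e 7) = t₃) (hu₃ : F (e 0) (e 3) (e 6) (e 7) = u₃) (x y z : ℝ) :
    (p₁ - y * s₁ - z * t₁) * ((q₂ + x * s₂ - z * u₂) * (r₃ + x * t₃ + y * u₃) -
          (r₂ + x * t₂ + y * u₂) * (q₃ + x * s₃ - z * u₃)) -
        (q₁ + x * s₁ - z * u₁) * ((p₂ - y * s₂ - z * t₂) * (r₃ + x * t₃ + y * u₃) -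
          (r₂ + x * t₂ + y * u₂) * (p₃ - y * s₃ - z * t₃)) +
        (r₁ + x * t₁ + y * u₁) * ((p₂ - y * s₂ - z * t₂) * (q₃ + x * s₃ - z * u₃) -
          (q₂ + x * s₂ - z * u₂) * (p₃ - y * s₃ - z * t₃)) =
      -δ * (1 + x ^ 2 + y ^ 2 + z ^ 2) := by
  have main := H (e 0) (e 4 + (x • e 5 + (y • e 6 + z • e 7))) (e 1) (e 2) (e 3) (e 5) (e 6) (e 7)
  have vol : D ![e 0, e 4, e 1, e 2, e 3, e 5, e 6, e 7] = -δ := by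
    set σ : Equiv.Perm (Fin 8) := Equiv.swap (3 : Fin 8) 4 * Equiv.swap (2 : Fin 8) 3 *
      Equiv.swap (1 : Fin 8) 2 with hσ
    have he : (![e 0, e 4, e 1, e 2, e 3, e 5, e 6, e 7] : Fin 8 → W) = e ∘ σ := by
      funext i; fin_cases i <;> rfl
    rw [he, D.map_perm, hσ, map_mul, map_mul, Equiv.Perm.sign_swap (by decide),
      Equiv.Perm.sign_swap (by decide), Equiv.Perm.sign_swap (by decide), h.volume]
    simp
  rw [map_add_slot, map_add_slot, map_add_slot, map_smul_slot, map_smul_slot, map_smul_slot, vol,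
    D.map_eq_zero_of_eq _ (i := 1) (j := 5) rfl (by decide),
    D.map_eq_zero_of_eq _ (i := 1) (j := 6) rfl (by decide),
    D.map_eq_zero_of_eq _ (i := 1) (j := 7) rfl (by decide)] at main
  obtain ⟨d1, d2, d3, d4⟩ := h.dual hF H hδ
  have sk : ∀ i j k, F (e 0) (e i) (e k) (e j) = -F (e 0) (e i) (e j) (e k) :=
    fun i j k => hF.swap₃₄ _ _ _ _
  have sw : ∀ i j k, F (e 0) (e j) (e i) (e k) = -F (e 0) (e i) (e j) (e k) :=
    fun i j k => hF.swap₂₃ _ _ _ _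
  have z : ∀ k, 4 ≤ k → F (e 0) (e k) (e 1) (e 2) = 0 ∧ F (e 0) (e k) (e 1) (e 3) = 0 ∧
      F (e 0) (e k) (e 2) (e 3) = 0 := by
    intro k hk
    rw [sw 1 k, sk 1 2 k, h.zero₁₂ k hk, sw 1 k, sk 1 3 k, h.zero₁₃ k hk, sw 2 k, sk 2 3 k,
      h.zero₂₃ k hk]
    simp
  have z4 := z 4 (by decide)
  have z5 := z 5 (by decide)
  have z6 := z 6 (by decide)
  have z7 := z 7 (by decide)
  simp only [pfaffian₆, map_add, map_smul, LinearMap.add_apply, LinearMap.smul_apply,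
    smul_eq_mul, z4, z5, z6, z7, hF.self₂₃, hF.self₂₄, d1, d2, d3, d4, sw 5 6 7, sw 5 7 6,
    sk 5 6 7,
    sw 1 4, sw 1 5, sw 1 6, sw 1 7, sw 2 4, sw 2 5, sw 2 6, sw 2 7,
    sw 3 4, sw 3 5, sw 3 6, sw 3 7, sk 1 5 6, sk 1 5 7, sk 1 6 7, sk 2 5 6, sk 2 5 7, sk 2 6 7,
    sk 3 5 6, sk 3 5 7, sk 3 6 7, hp₁, hq₁, hr₁, hs₁, ht₁, hu₁, hp₂, hq₂, hr₂, hs₂, ht₂,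
    hu₂, hp₃, hq₃, hr₃, hs₃, ht₃, hu₃,
    h.orthonormal _ _, Fin.reduceEq, reduceIte] at main
  linear_combination main

theorem value_eq_one (h : IsCriticalFrame g F D e c δ) (hF : IsSkew F) (H : HasPfaffian g F D)
    (hδ : δ ^ 2 = 1) (hc : 0 ≤ c) : c = 1 := by
  have hδ0 : δ ≠ 0 := by rintro rfl; norm_num at hδ
  have P₁ := h.pfaffian₁ H
  have P₂ := h.pfaffian₂ hF H
  have P₃ := (h.rotate₁₂₃ hF).pfaffian₂ hF H
  have P₁₂ := h.polar₁₂ hF H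
  have P₂₃ := (h.rotate₁₂₃ hF).polar₁₂ hF H
  have P₁₃ := (h.rotate₁₂₃ hF).rotate₁₂₃ hF |>.polar₁₂ hF H
  simp only [Matrix.cons_val] at P₃ P₂₃ P₁₃
  have hc0 : c ≠ 0 := by
    rintro rfl
    exact hδ0 (by simpa using P₁.symm)
  have hcd : c * (δ / c) = δ := mul_div_cancel₀ _ hc0
  have key := pfaffian_pow_six_eq_one (P := δ / c)
    (mul_left_cancel₀ hc0 (P₁.trans hcd.symm)) (mul_left_cancel₀ hc0 (P₂.trans hcd.symm))
    (mul_left_cancel₀ hc0 (P₃.trans hcd.symm)) ((mul_eq_zero.mp P₁₂).resolve_left hc0)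
    (by linear_combination (mul_eq_zero.mp P₁₃).resolve_left hc0)
    ((mul_eq_zero.mp P₂₃).resolve_left hc0) (ε := -δ) (by linear_combination hδ)
    (h.det_rows hF H hδ0 rfl rfl rfl rfl rfl rfl rfl rfl rfl rfl rfl rfl rfl rfl rfl rfl rfl rfl)
  rw [div_pow, div_eq_one_iff_eq (pow_ne_zero 6 hc0), show δ ^ 6 = (δ ^ 2) ^ 3 by ring, hδ,
    one_pow] at key
  exact (pow_eq_one_iff_of_nonneg hc (by norm_num)).mp key.symm

end IsCriticalFrame
end

/-! ### Unit norm of Φ(u,v,w,·) on orthonormal triples -/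

section

variable {W : Type*} [AddCommGroup W] [Module ℝ W]
variable {g : LinearMap.BilinForm ℝ W} {F : W →ₗ[ℝ] W →ₗ[ℝ] W →ₗ[ℝ] W →ₗ[ℝ] ℝ}
  {D : W [⋀^Fin 8]→ₗ[ℝ] ℝ}

theorem IsOrthonormal.cons (hg : IsInnerProduct g) {n : ℕ} {e : Fin n → W}
    (he : IsOrthonormal g e) {x : W} (hx : g x x = 1) (h : ∀ i, g (e i) x = 0) :
    IsOrthonormal g (Matrix.vecCons x e) := by
  intro i j
  refine Fin.cases ?_ (fun i => ?_) i <;> refine Fin.cases ?_ (fun j => ?_) j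
  · simpa using hx
  · simpa [hg.symm x, (Fin.succ_ne_zero j).symm] using h j
  · simpa [Fin.succ_ne_zero i] using h i
  · simpa using he i j

theorem IsOrthonormal.comp {n m : ℕ} {e : Fin n → W} (he : IsOrthonormal g e) {f : Fin m → Fin n}
    (hf : Function.Injective f) : IsOrthonormal g (e ∘ f) := by
  intro i j
  simp only [Function.comp, he (f i) (f j), hf.eq_iff]

theorem isOrthonormal_empty : IsOrthonormal g (![] : Fin 0 → W) := fun i => i.elim0

theorem isOrthonormal_triple (hg : IsInnerProduct g) {u v w : W} (hu : g u u = 1) (hv : g v v = 1)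
    (hw : g w w = 1) (huv : g u v = 0) (huw : g u w = 0) (hvw : g v w = 0) :
    IsOrthonormal g ![w, v, u] :=
  ((isOrthonormal_empty.cons hg hu (by simp)).cons hg hv (by simpa using huv)).cons hg hw
    (by intro i; fin_cases i; exacts [hvw, huw])

theorem IsOrthonormal.exists_cons (hg : IsInnerProduct g) {n : ℕ} (hn : n < Module.finrank ℝ W)
    {e : Fin n → W} (he : IsOrthonormal g e) : ∃ x, IsOrthonormal g (Matrix.vecCons x e) := by
  obtain ⟨x, hx, h⟩ := hg.exists_unit_orthogonal hn e
  exact ⟨x, he.cons hg hx h⟩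

theorem IsSkew.self₁₄ (hF : IsSkew F) (u v w : W) : F u v w u = 0 := by
  have := hF.swap₁₂ u u v w
  rw [hF.swap₃₄, hF.swap₂₃]
  linarith

theorem IsSkew.exists_isCriticalFrame (hF : IsSkew F) (hg : IsInnerProduct g)
    (hW : Module.finrank ℝ W = 8) (H : HasPfaffian g F D)
    (hD : ∀ e, IsOrthonormal g e → D e ^ 2 = 1) :
    ∃ e c, IsCriticalFrame g F D e c (D e) ∧ 0 ≤ c ∧
      ∀ a b c' d, g a a = 1 → g b b = 1 → g c' c' = 1 → g d d = 1 → F a b c' d ≤ c := by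
  obtain ⟨a, b, c, d, ha, hb, hc, hd, hmax⟩ := hg.exists_max (by omega) F
  have hW0 : 0 < Module.finrank ℝ W := by omega
  set m := F a b c d with hm
  have hneg : -m ≤ m := by
    have := hmax a b c (-d) ha hb hc (by simpa using hd)
    rwa [map_neg] at this
  have hm0 : 0 ≤ m := by linarith
  -- If m = 0, F vanishes on all unit vectors and every Pfaffian is zero, against the unit volume of
  -- an orthonormal frame.
  have hm1 : m ≠ 0 := by
    intro h0
    rw [h0] at hmax
    obtain ⟨x₁, e₁⟩ := (isOrthonormal_empty (g := g)).exists_cons hg (by omega)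
    obtain ⟨x₂, e₂⟩ := e₁.exists_cons hg (by omega)
    obtain ⟨x₃, e₃⟩ := e₂.exists_cons hg (by omega)
    obtain ⟨x₄, e₄⟩ := e₃.exists_cons hg (by omega)
    obtain ⟨x₅, e₅⟩ := e₄.exists_cons hg (by omega)
    obtain ⟨x₆, e₆⟩ := e₅.exists_cons hg (by omega)
    obtain ⟨x₇, e₇⟩ := e₆.exists_cons hg (by omega)
    obtain ⟨x₈, e₈⟩ := e₇.exists_cons hg (by omega)
    have z : ∀ a b c d, g a a = 1 → g b b = 1 → g c c = 1 → g d d = 1 → F a b c d = 0 := by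
      intro a b c d ha hb hc hd
      have h1 := hmax a b c d ha hb hc hd
      have h2 := hmax a b c (-d) ha hb hc (by simpa using hd)
      rw [map_neg] at h2
      linarith
    have n : ∀ i, g (![x₈, x₇, x₆, x₅, x₄, x₃, x₂, x₁] i) (![x₈, x₇, x₆, x₅, x₄, x₃, x₂, x₁] i) = 1 :=
      fun i => by rw [e₈ i i, if_pos rfl]
    have hP := H x₈ x₇ x₆ x₅ x₄ x₃ x₂ x₁
    have n01 : g x₈ x₇ = 0 := e₈ 0 1
    simp only [pfaffian₆, z x₈ x₇ x₆ x₅ (n 0) (n 1) (n 2) (n 3), z x₈ x₇ x₆ x₄ (n 0) (n 1) (n 2) (n 4),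
      z x₈ x₇ x₆ x₃ (n 0) (n 1) (n 2) (n 5), z x₈ x₇ x₆ x₂ (n 0) (n 1) (n 2) (n 6),
      z x₈ x₇ x₆ x₁ (n 0) (n 1) (n 2) (n 7)] at hP
    rw [show g x₈ x₈ = 1 from n 0, show g x₇ x₇ = 1 from n 1, n01] at hP
    have := hD _ e₈
    norm_num at hP
    rw [← hP] at this
    norm_num at this
  -- Criticality in the slots of d, c and b. Skewness then makes a, b, c, d orthogonal, and any
  -- orthonormal completion works.
  have fd : ∀ x, F a b c x = m * g d x := hg.eq_of_forall_le hW0 (F a b c) hd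
    fun x hx => hmax a b c x ha hb hc hx
  have fc : ∀ x, F a b d x = -(m * g c x) := fun x => by
    rw [hF.swap₃₄]
    exact congrArg _ (hg.eq_of_forall_le hW0 ((F a b).flip d) hc
      (fun x hx => hmax a b x d ha hb hx hd) x)
  have fb : ∀ x, F a c d x = m * g b x := fun x => by
    rw [hF.swap₃₄, hF.swap₂₃, neg_neg]
    exact hg.eq_of_forall_le hW0 (((F a).flip c).flip d) hb (fun x hx => hmax a x c d ha hx hc hd) x
  have oda : g d a = 0 := (mul_eq_zero.mp ((fd a).symm.trans (hF.self₁₄ _ _ _))).resolve_left hm1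
  have odb : g d b = 0 := (mul_eq_zero.mp ((fd b).symm.trans (hF.self₂₄ _ _ _))).resolve_left hm1
  have odc : g d c = 0 := (mul_eq_zero.mp ((fd c).symm.trans (hF.self₃₄ _ _ _))).resolve_left hm1
  have oca : g c a = 0 :=
    (mul_eq_zero.mp (neg_eq_zero.mp ((fc a).symm.trans (hF.self₁₄ _ _ _)))).resolve_left hm1
  have ocb : g c b = 0 :=
    (mul_eq_zero.mp (neg_eq_zero.mp ((fc b).symm.trans (hF.self₂₄ _ _ _)))).resolve_left hm1
  have oba : g b a = 0 := (mul_eq_zero.mp ((fb a).symm.trans (hF.self₁₄ _ _ _))).resolve_left hm1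
  have e₄ : IsOrthonormal g ![a, b, c, d] :=
    (isOrthonormal_triple hg hd hc hb odc odb ocb).cons hg ha
      (by intro i; fin_cases i; exacts [oba, oca, oda])
  obtain ⟨x₅, e₅⟩ := e₄.exists_cons hg (by omega)
  obtain ⟨x₆, e₆⟩ := e₅.exists_cons hg (by omega)
  obtain ⟨x₇, e₇⟩ := e₆.exists_cons hg (by omega)
  obtain ⟨x₈, e₈⟩ := e₇.exists_cons hg (by omega)
  have he := e₈.comp (f := ![4, 5, 6, 7, 0, 1, 2, 3]) (by decide)
  have hfr : (![x₈, x₇, x₆, x₅, a, b, c, d] : Fin 8 → W) ∘ ![4, 5, 6, 7, 0, 1, 2, 3] =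
      ![a, b, c, d, x₈, x₇, x₆, x₅] := by
    funext i; fin_cases i <;> rfl
  rw [hfr] at he
  have off : ∀ i k : Fin 8, i < 4 → 4 ≤ k → g (![a, b, c, d, x₈, x₇, x₆, x₅] i)
      (![a, b, c, d, x₈, x₇, x₆, x₅] k) = 0 := fun i k hi hk => by
    rw [he i k, if_neg (hi.trans_le hk).ne]
  refine ⟨_, m, ⟨he, rfl, rfl, fun k hk => ?_, fun k hk => ?_, fun k hk => ?_⟩, hm0, hmax⟩
  · exact (fd _).trans (by rw [show g d _ = 0 from off 3 k (by decide) hk, mul_zero])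
  · exact (fc _).trans (by rw [show g c _ = 0 from off 2 k (by decide) hk, mul_zero, neg_zero])
  · exact (fb _).trans (by rw [show g b _ = 0 from off 1 k (by decide) hk, mul_zero])

-- In a frame where w pairs only with y, and x₃ only with x₄ and possibly y, the Pfaffian of
-- F(u,v,·,·) is s·s'·F(u,v,x₅,x₆). Its square is 1 and the maximum 1 bounds each factor, so s² = 1.
set_option maxHeartbeats 1000000 in
theorem IsSkew.exists_unit_of_orthonormal (hF : IsSkew F) (hg : IsInnerProduct g)
    (hW : Module.finrank ℝ W = 8) (H : HasPfaffian g F D)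
    (hD : ∀ e, IsOrthonormal g e → D e ^ 2 = 1) {u v w : W} (he : IsOrthonormal g ![w, v, u]) :
    ∃ y s, g y y = 1 ∧ g u y = 0 ∧ g v y = 0 ∧ g w y = 0 ∧ s ^ 2 = 1 ∧
      ∀ x, F u v w x = s * g y x := by
  obtain ⟨e, c, h, hc, hmax⟩ := hF.exists_isCriticalFrame hg hW H hD
  obtain rfl := h.value_eq_one hF H (hD _ h.orthonormal) hc
  obtain ⟨y, s, hy, oy, ry⟩ := hg.exists_unit_rep (by omega) ![w, v, u] (F u v w) (by
    intro i; fin_cases i; exacts [hF.self₃₄ _ _ _, hF.self₂₄ _ _ _, hF.self₁₄ _ _ _])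
  have e₄ := he.cons hg hy oy
  obtain ⟨x₃, e₅⟩ := e₄.exists_cons hg (by omega)
  have ouy : g u y = 0 := oy 2
  have ovy : g v y = 0 := oy 1
  have owy : g w y = 0 := oy 0
  have oyx : g y x₃ = 0 := e₅ 1 0
  have hx₃ : g x₃ x₃ = 1 := e₅ 0 0
  -- The y-component is subtracted to make x₄ orthogonal to y; it does not affect the Pfaffian,
  -- since y is already matched with w.
  obtain ⟨x₄, s', hx₄, ox₄, rx₄⟩ := hg.exists_unit_rep (by omega) ![x₃, y, w, v, u]
    (F u v x₃ - F u v x₃ y • g y) (by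
    intro i
    fin_cases i
    · change F u v x₃ x₃ - F u v x₃ y * g y x₃ = 0
      rw [hF.self₃₄, oyx]; ring
    · change F u v x₃ y - F u v x₃ y * g y y = 0
      rw [hy]; ring
    · change F u v x₃ w - F u v x₃ y * g y w = 0
      rw [hF.swap₃₄, ry, hg.symm y w, owy, oyx]; ring
    · change F u v x₃ v - F u v x₃ y * g y v = 0
      rw [hF.self₂₄, hg.symm y v, ovy]; ring
    · change F u v x₃ u - F u v x₃ y * g y u = 0
      rw [hF.self₁₄, hg.symm y u, ouy]; ring)
  have e₆ := e₅.cons hg hx₄ ox₄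
  obtain ⟨x₅, e₇⟩ := e₆.exists_cons hg (by omega)
  obtain ⟨x₆, e₈⟩ := e₇.exists_cons hg (by omega)
  refine ⟨y, s, hy, ouy, ovy, owy, ?_, ry⟩
  have o : ∀ i, g (![x₆, x₅, x₄, x₃, y, w, v, u] i) (![x₆, x₅, x₄, x₃, y, w, v, u] i) = 1 :=
    fun i => (e₈ i i).trans (if_pos rfl)
  have uu : g u u = 1 := o 7
  have vv : g v v = 1 := o 6
  have ww : g w w = 1 := o 5
  have uv : g u v = 0 := e₈ 7 6
  have a3 : F u v w x₃ = 0 := by rw [ry, oyx, mul_zero]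
  have a4 : F u v w x₄ = 0 := by rw [ry, show g y x₄ = 0 from e₈ 4 2, mul_zero]
  have a5 : F u v w x₅ = 0 := by rw [ry, show g y x₅ = 0 from e₈ 4 1, mul_zero]
  have a6 : F u v w x₆ = 0 := by rw [ry, show g y x₆ = 0 from e₈ 4 0, mul_zero]
  have ay : F u v w y = s := by rw [ry, hy, mul_one]
  have b : ∀ z, g y z = 0 → F u v x₃ z = s' * g x₄ z := by
    intro z hz
    rw [← rx₄]
    simp [hz]
  have b4 : F u v x₃ x₄ = s' := by rw [b x₄ (e₈ 4 2), hx₄, mul_one]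
  have b5 : F u v x₃ x₅ = 0 := by rw [b x₅ (e₈ 4 1), show g x₄ x₅ = 0 from e₈ 2 1, mul_zero]
  have b6 : F u v x₃ x₆ = 0 := by rw [b x₆ (e₈ 4 0), show g x₄ x₆ = 0 from e₈ 2 0, mul_zero]
  have hP := H u v w y x₃ x₄ x₅ x₆
  simp only [pfaffian₆, ay, a3, a4, a5, a6, b4, b5, b6, uu, vv, uv] at hP
  have hDe := hD ![u, v, w, y, x₃, x₄, x₅, x₆] (by
    have := e₈.comp (f := ![7, 6, 5, 4, 3, 2, 1, 0]) (by decide)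
    rwa [show (![x₆, x₅, x₄, x₃, y, w, v, u] : Fin 8 → W) ∘ ![7, 6, 5, 4, 3, 2, 1, 0] =
      ![u, v, w, y, x₃, x₄, x₅, x₆] by funext i; fin_cases i <;> rfl] at this)
  have bound : ∀ a b c d, g a a = 1 → g b b = 1 → g c c = 1 → g d d = 1 → F a b c d ^ 2 ≤ 1 := by
    intro a b c d ha hb hc hd
    have h1 := hmax a b c d ha hb hc hd
    have h2 := hmax a b c (-d) ha hb hc (by simpa using hd)
    rw [map_neg] at h2
    nlinarith
  have c1 := bound u v w y uu vv ww hy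
  have c2 := bound u v x₃ x₄ uu vv hx₃ hx₄
  have c3 := bound u v x₅ x₆ uu vv (o 1) (o 0)
  rw [ay] at c1
  rw [b4] at c2
  have prod : s ^ 2 * (s' ^ 2 * F u v x₅ x₆ ^ 2) = 1 := by
    rw [← hDe, show s ^ 2 * (s' ^ 2 * F u v x₅ x₆ ^ 2) = (s * (s' * F u v x₅ x₆)) ^ 2 by ring]
    congr 1
    linear_combination hP
  have c4 : s' ^ 2 * F u v x₅ x₆ ^ 2 ≤ 1 := mul_le_one₀ c2 (sq_nonneg _) c3
  nlinarith [sq_nonneg s]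

end

/-! ### Orthonormal frames, triple products and normalisation -/

section

variable {W : Type*} [AddCommGroup W] [Module ℝ W]
variable {g : LinearMap.BilinForm ℝ W}

theorem IsInnerProduct.ext_left (hg : IsInnerProduct g) {x y : W} (h : ∀ z, g x z = g y z) :
    x = y := by
  refine eq_of_sub_eq_zero (hg.eq_zero ?_)
  rw [LinearMap.map_sub₂, h, sub_self]

theorem IsInnerProduct.exists_unit_smul (hg : IsInnerProduct g) {k : ℕ}
    (hk : k < Module.finrank ℝ W) (y : Fin k → W) {z : W} (hz : ∀ i, g (y i) z = 0) :
    ∃ (x : W) (s : ℝ), g x x = 1 ∧ (∀ i, g (y i) x = 0) ∧ z = s • x := by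
  obtain ⟨x, s, hx, o, h⟩ := hg.exists_unit_rep hk y (g z) fun i => by rw [hg.symm, hz]
  exact ⟨x, s, hx, o, hg.ext_left fun w => by simp [h]⟩

theorem IsInnerProduct.exists_triangular (hg : IsInnerProduct g) (hW : 3 < Module.finrank ℝ W)
    (u v w : W) : ∃ (e₁ e₂ e₃ : W) (a b c d p q : ℝ), IsOrthonormal g ![e₃, e₂, e₁] ∧
      u = a • e₁ ∧ v = b • e₁ + c • e₂ ∧ w = d • e₁ + p • e₂ + q • e₃ := by
  obtain ⟨e₁, a, h₁, -, rfl⟩ := hg.exists_unit_smul (by omega) ![] (z := u) (by simp)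
  obtain ⟨e₂, c, h₂, o₂, hv⟩ := hg.exists_unit_smul (by omega) ![e₁] (z := v - g e₁ v • e₁)
    (by intro i; fin_cases i; simp [h₁])
  have h₁₂ : g e₁ e₂ = 0 := o₂ 0
  obtain ⟨e₃, q, h₃, o₃, hw⟩ := hg.exists_unit_smul (by omega) ![e₁, e₂]
    (z := w - g e₁ w • e₁ - g e₂ w • e₂)
    (by intro i; fin_cases i <;> simp [h₁, h₂, h₁₂, hg.symm e₂ e₁])
  refine ⟨e₁, e₂, e₃, a, g e₁ v, c, g e₁ w, g e₂ w, q,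
    isOrthonormal_triple hg h₁ h₂ h₃ h₁₂ (o₃ 0) (o₃ 1), rfl, ?_, ?_⟩
  · rw [← hv]; abel
  · rw [← hw]; abel

namespace IsOrthonormal

variable {e : Fin 8 → W}

theorem linearIndependent (he : IsOrthonormal g e) : LinearIndependent ℝ e := by
  rw [Fintype.linearIndependent_iff]
  intro c hc j
  have := congrArg (g (e j)) hc
  simpa [he j _] using this

theorem sum_eq (hW : Module.finrank ℝ W = 8) (he : IsOrthonormal g e) (x : W) :
    ∑ i, g (e i) x • e i = x := by
  have hs := he.linearIndependent.span_eq_top_of_card_eq_finrank (by simp [hW])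
  have hx : x ∈ Submodule.span ℝ (Set.range e) := hs ▸ Submodule.mem_top
  obtain ⟨c, rfl⟩ := (Submodule.mem_span_range_iff_exists_fun ℝ).mp hx
  simp [he _ _]

/-- The basis of an orthonormal family of eight vectors. -/
noncomputable def basis (hW : Module.finrank ℝ W = 8) (he : IsOrthonormal g e) :
    Module.Basis (Fin 8) ℝ W :=
  basisOfLinearIndependentOfCardEqFinrank he.linearIndependent (by simp [hW])

theorem coe_basis (hW : Module.finrank ℝ W = 8) (he : IsOrthonormal g e) :
    ⇑(he.basis hW) = e := coe_basisOfLinearIndependentOfCardEqFinrank _ _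

theorem map_sq_eq (hg : IsInnerProduct g) (hW : Module.finrank ℝ W = 8) (he : IsOrthonormal g e)
    {f : Fin 8 → W} (hf : IsOrthonormal g f) (D : W [⋀^Fin 8]→ₗ[ℝ] ℝ) : D f ^ 2 = D e ^ 2 := by
  have h1 := congrArg (fun A => A f) (D.eq_smul_basis_det (he.basis hW))
  simp only [AlternatingMap.smul_apply, he.coe_basis hW, smul_eq_mul] at h1
  have h2 : ((he.basis hW).toMatrix f).transpose * (he.basis hW).toMatrix f = 1 := by
    have hM : ∀ k i, (he.basis hW).toMatrix f k i = g (e k) (f i) := by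
      intro k i
      rw [Module.Basis.toMatrix_apply]
      conv_lhs => rw [← he.sum_eq hW (f i)]
      rw [map_sum, Finsupp.finsetSum_apply]
      have : ∀ j, (he.basis hW).repr (e j) = Finsupp.single j 1 := fun j => by
        have := (he.basis hW).repr_self j
        rwa [he.coe_basis hW] at this
      simp [this, Finsupp.single_apply]
    ext i j
    rw [Matrix.mul_apply, Matrix.one_apply, ← hf i j]
    conv_rhs => rw [← he.sum_eq hW (f j)]
    simp only [Matrix.transpose_apply, hM, map_sum, map_smul, hg.symm (f i)]
    exact Finset.sum_congr rfl fun k _ => mul_comm _ _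
  have h3 := congrArg Matrix.det h2
  rw [Matrix.det_mul, Matrix.det_transpose, Matrix.det_one, ← Module.Basis.det_apply] at h3
  rw [h1]
  linear_combination D e ^ 2 * h3

theorem map_ne_zero (hW : Module.finrank ℝ W = 8) (he : IsOrthonormal g e)
    {D : W [⋀^Fin 8]→ₗ[ℝ] ℝ} (hD : D ≠ 0) : D e ≠ 0 := by
  intro h
  apply hD
  rw [D.eq_smul_basis_det (he.basis hW), he.coe_basis hW, h, zero_smul]

end IsOrthonormal

theorem IsInnerProduct.exists_orthonormal (hg : IsInnerProduct g) (hW : Module.finrank ℝ W = 8) :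
    ∃ e : Fin 8 → W, IsOrthonormal g e := by
  have h : ∀ n ≤ 8, ∃ e : Fin n → W, IsOrthonormal g e := by
    intro n
    induction n with
    | zero => exact fun _ => ⟨![], isOrthonormal_empty⟩
    | succ n ih =>
      intro hn
      obtain ⟨e, he⟩ := ih (by omega)
      obtain ⟨x, hx⟩ := he.exists_cons hg (by omega)
      exact ⟨_, hx⟩
  exact h 8 le_rfl

theorem IsInnerProduct.smul (hg : IsInnerProduct g) {c : ℝ} (hc : 0 < c) :
    IsInnerProduct (c • g) where
  symm u v := by simp [hg.symm u v]
  pos u hu := by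
    simpa using mul_pos hc (hg.pos u hu)

/-- The product is Σ Φ(fᵢ,·,·,·) fᵢ over an orthonormal frame. A Gram–Schmidt triangular form
reduces the norm identity to orthonormal triples, both sides scaling by (acq)². -/
theorem isCompatible_of_orthonormal {B : LinearMap.BilinForm ℝ W} (hB : IsInnerProduct B)
    (hW : Module.finrank ℝ W = 8) {Φ : W [⋀^Fin 4]→ₗ[ℝ] ℝ}
    (h : ∀ u v w, IsOrthonormal B ![w, v, u] →
      ∃ y s, B y y = 1 ∧ s ^ 2 = 1 ∧ ∀ x, curried Φ u v w x = s * B y x) :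
    IsCompatible B Φ := by
  obtain ⟨f, hf⟩ := hB.exists_orthonormal hW
  set T : W [⋀^Fin 3]→ₗ[ℝ] W :=
    ∑ i, (LinearMap.toSpanSingleton ℝ W (f i)).compAlternatingMap (Φ.curryLeft (f i)) with hT
  have hF := isSkew_curried Φ
  have rot : ∀ x u v w, curried Φ x u v w = -curried Φ u v w x := fun x u v w => by
    rw [hF.swap₁₂, hF.swap₂₃, hF.swap₃₄]; ring
  have hTx : ∀ x u v w, B x (T ![u, v, w]) = curried Φ x u v w := by
    intro x u v w
    have : T ![u, v, w] = ∑ i, curried Φ (f i) u v w • f i := by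
      let ev : (W [⋀^Fin 3]→ₗ[ℝ] W) →+ W :=
        { toFun := fun A => A ![u, v, w], map_zero' := rfl, map_add' := fun _ _ => rfl }
      exact (congrArg ev hT).trans (map_sum ev _ _)
    rw [this, map_sum, rot]
    conv_rhs => rw [← hf.sum_eq hW x]
    rw [map_sum, ← Finset.sum_neg_distrib]
    refine Finset.sum_congr rfl fun i _ => ?_
    rw [map_smul, map_smul, rot, hB.symm x, smul_eq_mul, smul_eq_mul]
    ring
  refine ⟨hB, T, hTx, fun u v w => ?_, fun u v w => ?_, fun u v w => ?_, fun u v w => ?_⟩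
  · rw [hB.symm, hTx, rot, hF.self₁₄, neg_zero]
  · rw [hB.symm, hTx, rot, hF.self₂₄, neg_zero]
  · rw [hB.symm, hTx, rot, hF.self₃₄, neg_zero]
  · obtain ⟨e₁, e₂, e₃, a, b, c, d, p, q, he, rfl, rfl, rfl⟩ := hB.exists_triangular (by omega) u v w
    obtain ⟨y, s, hy, hs, hr⟩ := h e₁ e₂ e₃ he
    have key : ∀ x, curried Φ (a • e₁) (b • e₁ + c • e₂) (d • e₁ + p • e₂ + q • e₃) x =
        a * c * q * s * B y x := by
      intro x
      have z₁₂ : ∀ u w x, curried Φ u u w x = 0 := fun u w x => by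
        have := hF.swap₁₂ u u w x; linarith
      have z₁₃ : ∀ u w x, curried Φ u w u x = 0 := fun u w x => by
        rw [hF.swap₂₃, z₁₂, neg_zero]
      simp only [map_add, map_smul, LinearMap.add_apply, LinearMap.smul_apply, smul_eq_mul, z₁₂, z₁₃,
        hF.self₂₃, hr]
      ring
    have hTy : T ![a • e₁, b • e₁ + c • e₂, d • e₁ + p • e₂ + q • e₃] = (-(a * c * q * s)) • y :=
      hB.ext_left fun x => by
        rw [hB.symm, hTx, rot, key]
        simp
    rw [hTy]
    have o₁ : B e₁ e₁ = 1 := he 2 2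
    have o₂ : B e₂ e₂ = 1 := he 1 1
    have o₃ : B e₃ e₃ = 1 := he 0 0
    have o₁₂ : B e₁ e₂ = 0 := he 2 1
    have o₁₃ : B e₁ e₃ = 0 := he 2 0
    have o₂₃ : B e₂ e₃ = 0 := he 1 0
    have o₂₁ : B e₂ e₁ = 0 := he 1 2
    have o₃₁ : B e₃ e₁ = 0 := he 0 2
    have o₃₂ : B e₃ e₂ = 0 := he 0 1
    simp only [wedgeNormSq, Matrix.det_fin_three, map_add, map_smul, LinearMap.add_apply,
      LinearMap.smul_apply, smul_eq_mul, Matrix.cons_val, Matrix.of_apply,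
      o₁, o₂, o₃, o₁₂, o₁₃, o₂₃, o₂₁, o₃₁, o₃₂, hy]
    linear_combination (a * c * q) ^ 2 * hs

theorem exists_isCompatible_of_hasPfaffian (hg : IsInnerProduct g) (hW : Module.finrank ℝ W = 8)
    {Φ : W [⋀^Fin 4]→ₗ[ℝ] ℝ} {D : W [⋀^Fin 8]→ₗ[ℝ] ℝ} (H : HasPfaffian g (curried Φ) D)
    (hD : D ≠ 0) : ∃ B, IsCompatible B Φ := by
  obtain ⟨f, hf⟩ := hg.exists_orthonormal hW
  have hκ : 0 < |D f| := abs_pos.mpr (hf.map_ne_zero hW hD)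
  -- Passing to ν²g divides D by ν⁴ in the Pfaffian identity and shrinks orthonormal frames by ν,
  -- dividing D by a further ν⁸; hence the exponent 12.
  obtain ⟨ν, hν, hν12⟩ : ∃ ν : ℝ, 0 < ν ∧ ν ^ 12 = |D f| :=
    ⟨|D f| ^ (1 / 12 : ℝ), Real.rpow_pos_of_pos hκ _, by
      rw [← Real.rpow_natCast, ← Real.rpow_mul hκ.le]; norm_num⟩
  have hν24 : ν ^ 24 = D f ^ 2 := by rw [← sq_abs, ← hν12]; ring
  have hB := hg.smul (pow_pos hν 2)
  refine ⟨ν ^ 2 • g, isCompatible_of_orthonormal hB hW fun u v w he => ?_⟩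
  have H' : HasPfaffian (ν ^ 2 • g) (curried Φ) ((ν ^ 4)⁻¹ • D) := by
    intro u v x₁ x₂ x₃ x₄ x₅ x₆
    rw [H]
    simp only [LinearMap.smul_apply, AlternatingMap.smul_apply, smul_eq_mul]
    field_simp
  obtain ⟨y, s, hy, -, -, -, hs, h⟩ := (isSkew_curried Φ).exists_unit_of_orthonormal hB hW H' (by
    intro e he
    have he' : IsOrthonormal g fun i => ν • e i := by
      intro i j
      rw [← he i j]
      simp only [map_smul, LinearMap.smul_apply, smul_eq_mul]
      ring
    have h1 := hf.map_sq_eq hg hW he' D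
    rw [D.toMultilinearMap.map_smul_univ (fun _ => ν) e |> fun h => (show D (fun i => ν • e i) = _ from h)] at h1
    rw [← hν24] at h1
    simp at h1
    simp only [AlternatingMap.smul_apply, smul_eq_mul]
    field_simp
    have h2 : ν ^ 16 * (D e ^ 2) = ν ^ 16 * ν ^ 8 := by linear_combination h1
    rw [mul_left_cancel₀ (pow_pos hν 16).ne' h2]) he
  exact ⟨y, s, hy, hs, h⟩

end

/-! ### The two implications and uniqueness -/

section

variable {W : Type*} [AddCommGroup W] [Module ℝ W]
variable {B : LinearMap.BilinForm ℝ W} {Φ : W [⋀^Fin 4]→ₗ[ℝ] ℝ}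

theorem Nondegenerate.exists_basis_pos (hW : Module.finrank ℝ W = 8) (hΦ : Nondegenerate Φ) :
    ∃ e : Module.Basis (Fin 8) ℝ W, ∀ u v, LinearIndependent ℝ ![u, v] →
      0 < eightFormAt Φ e u v u v := by
  have : FiniteDimensional ℝ W := FiniteDimensional.of_finrank_pos (by omega)
  set e := Module.finBasisOfFinrankEq ℝ W hW
  have hne : ∀ u v, LinearIndependent ℝ ![u, v] → eightFormAt Φ e u v u v ≠ 0 := fun u v h h0 =>
    hΦ.eightForm_ne_zero hW h ((eightForm_eq_zero_iff e Φ u v u v).mpr h0)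
  rcases (isBivectorForm_eightFormAt Φ e).pos_or_neg (by omega) hne with h | h
  · exact ⟨e, h⟩
  · refine ⟨e.reindex (Equiv.swap 0 1), fun u v huv => ?_⟩
    have := h u v huv
    rw [eightFormAt_apply] at this ⊢
    rw [Module.Basis.coe_reindex, Equiv.symm_swap, AlternatingMap.map_swap _ _ (by decide)]
    linarith

theorem eightForm_self_eq_smul_det (e : Module.Basis (Fin 8) ℝ W) (Φ : W [⋀^Fin 4]→ₗ[ℝ] ℝ)
    (u v : W) (y : Fin 8 → W) : eightForm Φ u v u v y = eightFormAt Φ e u v u v * e.det y := by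
  rw [eightFormAt_apply]
  conv_lhs => rw [(eightForm Φ u v u v).eq_smul_basis_det e, AlternatingMap.smul_apply, smul_eq_mul]

theorem ConditionC.exists_isCompatible (hW : Module.finrank ℝ W = 8) (h : ConditionC Φ) :
    ∃ B, IsCompatible B Φ := by
  obtain ⟨e, he⟩ := h.1.exists_basis_pos hW
  have hR : IsConformalBivectorForm (eightFormAt Φ e) :=
    { isBivectorForm_eightFormAt Φ e with
      pos := he
      cond := fun u v w hli h1 h2 x => by
        rw [← eightForm_eq_zero_iff] at h1 h2 ⊢
        rw [← eightForm_eq_zero_iff]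
        exact h.2 u v w hli h1 h2 x }
  obtain ⟨g, hg, hgR⟩ := hR.exists_innerProduct hW
  -- The factor 1/6 cancels the 3! in ω∧ω∧ω = 3! Pf(ω).
  refine exists_isCompatible_of_hasPfaffian (D := (6 : ℝ)⁻¹ • e.det) hg hW ?_ ?_
  · intro u v x₁ x₂ x₃ x₄ x₅ x₆
    have h1 := eightForm_self_apply Φ u v x₁ x₂ x₃ x₄ x₅ x₆
    have h2 := eightForm_self_eq_smul_det e Φ u v ![u, v, x₁, x₂, x₃, x₄, x₅, x₆]
    rw [hgR] at h2
    rw [AlternatingMap.smul_apply, smul_eq_mul]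
    linear_combination (h2 - h1) / 6
  · exact smul_ne_zero (by norm_num) e.det_ne_zero

namespace IsCompatible

/-- If Φ(u,v,w,·) = 0, the triple product vanishes, hence so does the Gram determinant (acq)² in
triangular form. -/
theorem nondegenerate (hW : Module.finrank ℝ W = 8) (h : IsCompatible B Φ) : Nondegenerate Φ := by
  obtain ⟨hB, T, hT, hcross⟩ := h
  intro u v w hli
  by_contra! h0
  have hT0 : T ![u, v, w] = 0 := hB.ext_left fun x => by
    have := h0 x
    rw [← curried_apply, curried_swap₃₄, curried_swap₂₃, curried_swap₁₂, curried_apply, ← hT,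
      hB.symm] at this
    simpa using this
  have hN := hcross.norm_sq u v w
  rw [hT0] at hN
  obtain ⟨e₁, e₂, e₃, a, b, c, d, p, q, he, rfl, rfl, rfl⟩ := hB.exists_triangular (by omega) u v w
  have o₁ : B e₁ e₁ = 1 := he 2 2
  have o₂ : B e₂ e₂ = 1 := he 1 1
  have o₃ : B e₃ e₃ = 1 := he 0 0
  have o₁₂ : B e₁ e₂ = 0 := he 2 1
  have o₁₃ : B e₁ e₃ = 0 := he 2 0
  have o₂₃ : B e₂ e₃ = 0 := he 1 0
  have o₂₁ : B e₂ e₁ = 0 := he 1 2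
  have o₃₁ : B e₃ e₁ = 0 := he 0 2
  have o₃₂ : B e₃ e₂ = 0 := he 0 1
  simp only [wedgeNormSq, Matrix.det_fin_three, map_add, map_smul, LinearMap.add_apply,
    LinearMap.smul_apply, smul_eq_mul, Matrix.cons_val, Matrix.of_apply, map_zero,
    o₁, o₂, o₃, o₁₂, o₁₃, o₂₃, o₂₁, o₃₁, o₃₂] at hN
  have hq : a * c * q = 0 := pow_eq_zero_iff two_ne_zero |>.mp (by linear_combination -hN)
  rw [linearIndependent_triple_iff] at hli
  have ha : a ≠ 0 := by
    rintro rfl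
    exact one_ne_zero (hli 1 0 0 (by simp)).1
  have hc : c ≠ 0 := by
    rintro rfl
    exact ha (hli (-b) a 0 (by module)).2.1
  have hq0 : q = 0 := (mul_eq_zero.mp hq).resolve_left (mul_ne_zero ha hc)
  subst hq0
  exact mul_ne_zero ha hc (hli (p * b - c * d) (-(a * p)) (a * c) (by module)).2.2

/-- On the complement of u, v the map A is skew and isometric, so an orthogonal complex structure. A
unitary frame x, Ax puts Φ(u,v,·,·) in standard form. -/
theorem exists_pfaffian_eq_one (hW : Module.finrank ℝ W = 8) (h : IsCompatible B Φ) {u v : W}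
    (he : IsOrthonormal B ![v, u]) : ∃ x₁ x₂ x₃ x₄ x₅ x₆ : W,
      IsOrthonormal B ![x₆, x₅, x₄, x₃, x₂, x₁, v, u] ∧
      pfaffian₆ (fun s t => curried Φ u v s t) x₁ x₂ x₃ x₄ x₅ x₆ = 1 := by
  obtain ⟨hB, T, hT, hcross⟩ := h
  have hF := isSkew_curried Φ
  have hu : B u u = 1 := he 1 1
  have hv : B v v = 1 := he 0 0
  have huv : B u v = 0 := he 1 0
  have hvu : B v u = 0 := he 0 1
  -- the linear map `A x = x × u × v`
  obtain ⟨A, hA⟩ : ∃ A : W →ₗ[ℝ] W, ∀ x, A x = -T ![u, v, x] :=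
    ⟨-(((T.curryLeft u).curryLeft v).toMultilinearMap.toLinearMap ![0] 0), fun x => by
      simp only [LinearMap.neg_apply, MultilinearMap.toLinearMap_apply]
      have : Function.update ![(0 : W)] 0 x = ![x] := by funext i; fin_cases i; rfl
      rw [this]
      rfl⟩
  have hAF : ∀ x y, curried Φ u v x y = B (A x) y := fun x y => by
    rw [hF.swap₃₄, hF.swap₂₃, hF.swap₁₂, hA, curried_apply, ← hT, hB.symm]
    simp
  have hAu : ∀ x, B u (A x) = 0 := fun x => by rw [hB.symm, ← hAF, hF.self₁₄]
  have hAv : ∀ x, B v (A x) = 0 := fun x => by rw [hB.symm, ← hAF, hF.self₂₄]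
  have hAx : ∀ x, B x (A x) = 0 := fun x => by rw [hB.symm, ← hAF, hF.self₃₄]
  have hAn : ∀ x, B u x = 0 → B v x = 0 → B (A x) (A x) = B x x := by
    intro x hux hvx
    have := hcross.norm_sq u v x
    rw [hA]
    simp only [wedgeNormSq, Matrix.det_fin_three, Matrix.cons_val, Matrix.of_apply, hu, hv, huv,
      hvu, hux, hvx] at this
    simp only [map_neg, LinearMap.neg_apply, neg_neg]
    linear_combination this
  have hAA : ∀ x y, B u x = 0 → B v x = 0 → B u y = 0 → B v y = 0 → B (A x) (A y) = B x y := by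
    intro x y hux hvx huy hvy
    have h1 := hAn (x + y) (by simp [hux, huy]) (by simp [hvx, hvy])
    have h2 := hAn x hux hvx
    have h3 := hAn y huy hvy
    simp only [map_add, LinearMap.add_apply, hB.symm y x, hB.symm (A y) (A x)] at h1
    linarith
  have hAsk : ∀ x y, B x (A y) = -B y (A x) := fun x y => by
    rw [hB.symm, ← hAF, hF.swap₃₄, hAF, hB.symm]
  obtain ⟨x₁, e₁⟩ := he.exists_cons hB (by omega)
  have u₁ : B u x₁ = 0 := e₁ 2 0
  have v₁ : B v x₁ = 0 := e₁ 1 0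
  have n₁ : B x₁ x₁ = 1 := e₁ 0 0
  have e₂ := e₁.cons hB ((hAn x₁ u₁ v₁).trans n₁)
    (by intro i; fin_cases i; exacts [hAx _, hAv _, hAu _])
  obtain ⟨x₃, e₃⟩ := e₂.exists_cons hB (by omega)
  have u₃ : B u x₃ = 0 := e₃ 4 0
  have v₃ : B v x₃ = 0 := e₃ 3 0
  have n₃ : B x₃ x₃ = 1 := e₃ 0 0
  have o₁₃ : B x₁ x₃ = 0 := e₃ 2 0
  have o₂₃ : B (A x₁) x₃ = 0 := e₃ 1 0
  have o₂₄ : B (A x₁) (A x₃) = 0 := (hAA x₁ x₃ u₁ v₁ u₃ v₃).trans o₁₃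
  have o₁₄ : B x₁ (A x₃) = 0 := by rw [hAsk, hB.symm, o₂₃, neg_zero]
  have e₄ := e₃.cons hB ((hAn x₃ u₃ v₃).trans n₃)
    (by intro i; fin_cases i; exacts [hAx _, o₂₄, o₁₄, hAv _, hAu _])
  obtain ⟨x₅, e₅⟩ := e₄.exists_cons hB (by omega)
  have u₅ : B u x₅ = 0 := e₅ 6 0
  have v₅ : B v x₅ = 0 := e₅ 5 0
  have n₅ : B x₅ x₅ = 1 := e₅ 0 0
  have o₁₅ : B x₁ x₅ = 0 := e₅ 4 0
  have o₂₅ : B (A x₁) x₅ = 0 := e₅ 3 0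
  have o₃₅ : B x₃ x₅ = 0 := e₅ 2 0
  have o₄₅ : B (A x₃) x₅ = 0 := e₅ 1 0
  have o₂₆ : B (A x₁) (A x₅) = 0 := (hAA x₁ x₅ u₁ v₁ u₅ v₅).trans o₁₅
  have o₁₆ : B x₁ (A x₅) = 0 := by rw [hAsk, hB.symm, o₂₅, neg_zero]
  have o₄₆ : B (A x₃) (A x₅) = 0 := (hAA x₃ x₅ u₃ v₃ u₅ v₅).trans o₃₅
  have o₃₆ : B x₃ (A x₅) = 0 := by rw [hAsk, hB.symm, o₄₅, neg_zero]
  have e₆ := e₅.cons hB ((hAn x₅ u₅ v₅).trans n₅)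
    (by intro i; fin_cases i; exacts [hAx _, o₄₆, o₃₆, o₂₆, o₁₆, hAv _, hAu _])
  refine ⟨x₁, A x₁, x₃, A x₃, x₅, A x₅, e₆, ?_⟩
  simp only [pfaffian₆, hAF, hAn x₁ u₁ v₁, n₁, hAn x₃ u₃ v₃, n₃, hAn x₅ u₅ v₅, n₅, o₂₃, o₂₄, o₂₅,
    o₂₆, o₄₅, o₄₆]
  ring

/-- The bivector form of a 4-form with compatible inner product is a multiple of the one
induced by the inner product. -/
theorem exists_eightFormAt_eq (hW : Module.finrank ℝ W = 8) (h : IsCompatible B Φ)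
    {e : Module.Basis (Fin 8) ℝ W}
    (he : ∀ u v, LinearIndependent ℝ ![u, v] → 0 < eightFormAt Φ e u v u v) :
    ∃ k : ℝ, 0 < k ∧ ∀ u v w, eightFormAt Φ e u v u w = k * (B u u * B v w - B u v * B u w) := by
  have hB := h.1
  obtain ⟨f, hf⟩ := hB.exists_orthonormal hW
  have hd : 0 < |e.det f| := abs_pos.mpr (hf.map_ne_zero hW e.det_ne_zero)
  have hR := isBivectorForm_eightFormAt Φ e
  have horth : ∀ u v, IsOrthonormal B ![v, u] → eightFormAt Φ e u v u v = 6 / |e.det f| := by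
    intro u v huv
    obtain ⟨x₁, x₂, x₃, x₄, x₅, x₆, ho, hp⟩ := h.exists_pfaffian_eq_one hW huv
    have h1 := eightForm_self_apply Φ u v x₁ x₂ x₃ x₄ x₅ x₆
    have h2 := eightForm_self_eq_smul_det e Φ u v ![u, v, x₁, x₂, x₃, x₄, x₅, x₆]
    have ho' := ho.comp (f := ![7, 6, 5, 4, 3, 2, 1, 0]) (by decide)
    rw [show (![x₆, x₅, x₄, x₃, x₂, x₁, v, u] : Fin 8 → W) ∘ ![7, 6, 5, 4, 3, 2, 1, 0] =
      ![u, v, x₁, x₂, x₃, x₄, x₅, x₆] by funext i; fin_cases i <;> rfl] at ho'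
    have h3 := hf.map_sq_eq hB hW ho' e.det
    rw [h2, hp] at h1
    have hli : LinearIndependent ℝ ![u, v] := by
      have o₁ : B u u = 1 := huv 1 1
      have o₂ : B v v = 1 := huv 0 0
      have o₁₂ : B u v = 0 := huv 1 0
      rw [linearIndependent_pair_iff_forall (by rintro rfl; simp at o₁)]
      rintro s rfl
      simp [o₁] at o₁₂
      simp [o₁₂] at o₂
    have h4 := he u v hli
    generalize e.det ![u, v, x₁, x₂, x₃, x₄, x₅, x₆] = D at h1 h3
    rw [← (sq_eq_sq_iff_abs_eq_abs _ _).mp h3, eq_div_iff (by rintro h0; simp [abs_eq_zero.mp h0] at h1),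
      ← abs_of_pos h4, ← abs_mul, h1]
    norm_num
  refine ⟨6 / |e.det f|, by positivity, ?_⟩
  have hsec : ∀ u v, eightFormAt Φ e u v u v = 6 / |e.det f| * (B u u * B v v - B u v ^ 2) := by
    intro u v
    obtain ⟨e₁, e₂, e₃, a, b, c, d, p, q, ho, rfl, rfl, -⟩ := hB.exists_triangular (by omega) u v 0
    have o₁ : B e₁ e₁ = 1 := ho 2 2
    have o₂ : B e₂ e₂ = 1 := ho 1 1
    have o₁₂ : B e₁ e₂ = 0 := ho 2 1
    have o₂₁ : B e₂ e₁ = 0 := ho 1 2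
    have := horth e₁ e₂ (ho.comp (f := ![1, 2]) (by decide) |> fun hh => by
      rwa [show (![e₃, e₂, e₁] : Fin 3 → W) ∘ ![1, 2] = ![e₂, e₁] by
        funext i; fin_cases i <;> rfl] at hh)
    simp only [map_add, map_smul, LinearMap.add_apply, LinearMap.smul_apply, smul_eq_mul, hR.self,
      hR.self', this, o₁, o₂, o₁₂, o₂₁]
    ring
  intro u v w
  have h1 := hsec u (v + w)
  have h2 := hsec u v
  have h3 := hsec u w
  have h4 := hR.pair_symm u v u w
  simp only [map_add, LinearMap.add_apply, hB.symm w v] at h1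
  linear_combination (h1 - h2 - h3 - h4) / 2

theorem conditionC (hW : Module.finrank ℝ W = 8) (h : IsCompatible B Φ) : ConditionC Φ := by
  have hnd := h.nondegenerate hW
  refine ⟨hnd, fun u v w hli h1 h2 x => ?_⟩
  obtain ⟨e, he⟩ := hnd.exists_basis_pos hW
  obtain ⟨k, hk, hR⟩ := h.exists_eightFormAt_eq hW he
  have hB := h.1
  have hu : u ≠ 0 := hli.ne_zero 0
  have hv : v ≠ 0 := hli.ne_zero 1
  have huv : LinearIndependent ℝ ![u, v] := by
    rw [linearIndependent_pair_iff_forall hu]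
    rintro s rfl
    have := (linearIndependent_triple_iff.mp hli) s (-1) 0 (by module)
    norm_num at this
  have hpos := he u v huv
  rw [eightForm_eq_zero_iff e, hR, mul_eq_zero_iff_left hk.ne'] at h1 h2
  rw [hR] at hpos
  have hG : B u u * B v v - B u v * B u v ≠ 0 := fun h0 => by rw [h0, mul_zero] at hpos; exact hpos.false
  -- The hypotheses are a linear system in B(u,w), B(v,w) whose determinant is the Gram determinant
  -- of u, v.
  have hvw : B v w = 0 := (mul_eq_zero.mp (show (B u u * B v v - B u v * B u v) * B v w = 0 by
    rw [hB.symm v u] at h2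
    linear_combination B v v * h1 + B u v * h2)).resolve_left hG
  have huw : B u w = 0 := (mul_eq_zero.mp (show (B u u * B v v - B u v * B u v) * B u w = 0 by
    rw [hB.symm v u] at h2
    linear_combination B u v * h1 + B u u * h2)).resolve_left hG
  rw [eightForm_eq_zero_iff e, eightForm_eq_zero_iff e, hR, hR, hvw, huw]
  simp [hk.ne', (hB.pos u hu).ne', (hB.pos v hv).ne']

/-- Both inner products induce the same bivector form up to positive factors, so B-orthogonality
implies B'-orthogonality and B' = tB. -/
theorem unique (hW : Module.finrank ℝ W = 8) {B' : LinearMap.BilinForm ℝ W}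
    (h : IsCompatible B Φ) (h' : IsCompatible B' Φ) : B = B' := by
  obtain ⟨e, he⟩ := (h.nondegenerate hW).exists_basis_pos hW
  obtain ⟨k, hk, hR⟩ := h.exists_eightFormAt_eq hW he
  obtain ⟨k', hk', hR'⟩ := h'.exists_eightFormAt_eq hW he
  have hB := h.1
  have hB' := h'.1
  have hS : ∀ u v w, k * (B u u * B v w - B u v * B u w) =
      k' * (B' u u * B' v w - B' u v * B' u w) := fun u v w => (hR u v w).symm.trans (hR' u v w)
  have hperp : ∀ w x, B w x = 0 → B' w x = 0 := by
    intro w x hwx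
    by_cases hx : x = 0
    · simp [hx]
    -- An auxiliary v orthogonal to w and x provides two relations that form an invertible system in
    -- B'(v,w), B'(x,w).
    obtain ⟨v, hv, hv0⟩ := hB.exists_unit_orthogonal (k := 2) (by omega) ![w, x]
    have wv : B w v = 0 := hv0 0
    have xv : B x v = 0 := hv0 1
    have h1 := hS x v w
    have h2 := hS v x w
    have h3 := hS x v v
    rw [xv, hB.symm v w, wv] at h1
    rw [hB.symm v x, xv, hB.symm x w, hwx] at h2
    rw [xv, hv] at h3
    have hG : B' x x * B' v v - B' x v * B' x v ≠ 0 := fun h0 => by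
      rw [h0] at h3
      have := mul_pos hk (hB.pos x hx)
      linarith
    have g1 : B' x x * B' v w - B' x v * B' x w = 0 :=
      (mul_eq_zero.mp (show k' * _ = 0 by rw [← h1]; ring)).resolve_left hk'.ne'
    have g2 : B' v v * B' x w - B' v x * B' v w = 0 :=
      (mul_eq_zero.mp (show k' * _ = 0 by rw [← h2]; ring)).resolve_left hk'.ne'
    rw [hB'.symm w x]
    refine (mul_eq_zero.mp (show (B' x x * B' v v - B' x v * B' x v) * B' x w = 0 from ?_)).resolve_left hG
    rw [hB'.symm v x] at g2
    linear_combination B' x v * g1 + B' x x * g2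
  obtain ⟨t, ht⟩ := exists_proportional B B' hB.symm hB'.symm ⊤ (fun w _ hw => hB.pos w hw)
    fun w _ x => hperp w x
  have hB't : ∀ w x, B' w x = t * B w x := fun w x => ht w trivial x
  obtain ⟨f, hf⟩ := hB.exists_orthonormal hW
  obtain ⟨-, T, hT, hc⟩ := h
  obtain ⟨-, T', hT', hc'⟩ := h'
  have ht0 : 0 < t := by
    have h00 : B (f 0) (f 0) = 1 := hf 0 0
    have := hB'.pos (f 0) (by rintro h0; simp [h0] at h00)
    rwa [hB't, h00, mul_one] at this
  have hTT : T ![f 0, f 1, f 2] = t • T' ![f 0, f 1, f 2] := hB.ext_left fun x => by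
    rw [hB.symm, hT, ← hT', hB't, hB.symm x]
    simp
  have n := hc.norm_sq (f 0) (f 1) (f 2)
  have n' := hc'.norm_sq (f 0) (f 1) (f 2)
  rw [hTT] at n
  simp only [wedgeNormSq, Matrix.det_fin_three, Matrix.cons_val, Matrix.of_apply, hB't, map_smul,
    LinearMap.smul_apply, smul_eq_mul, hf _ _, Fin.reduceEq, reduceIte] at n n'
  -- On a B-orthonormal triple the Gram determinant of B' is t³, while T = tT' gives 1 = t²B(T',T')
  -- = t·B'(T',T').
  have h4 : t ^ 4 = 1 := by linear_combination n - t * n'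
  have h1 : t = 1 := (pow_eq_one_iff_of_nonneg ht0.le (by norm_num)).mp h4
  ext w x
  rw [hB't, h1, one_mul]

end IsCompatible
end

end CayleyForm

theorem theorem6p4 {W : Type*} [AddCommGroup W] [Module ℝ W] (hW : Module.finrank ℝ W = 8)
    (Φ : W [⋀^Fin 4]→ₗ[ℝ] ℝ) :
    ((∃ B : LinearMap.BilinForm ℝ W, CayleyForm.IsCompatible B Φ) ↔ CayleyForm.ConditionC Φ) ∧
      ∀ B B' : LinearMap.BilinForm ℝ W,
        CayleyForm.IsCompatible B Φ → CayleyForm.IsCompatible B' Φ → B = B' :=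
  ⟨⟨fun ⟨_, hB⟩ => hB.conditionC hW, fun h => h.exists_isCompatible hW⟩,
    fun _ _ hB hB' => hB.unique hW hB'⟩
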